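/- Let $K$ be a field. Operads are non-symmetric operads in $K$-vector spaces with components $P(n)$, $n\ge 1$. The cells of the hypercube $I^m=[0,1]^m$ are the products of $m$ cells of $I$ (the cells of $I$ being its two end points and $I$ itself), i.e. words of length $m$ in three letters. Let $C_*(I^m)$ be the chain module with the cells as basis and $C^*(I^m)$ its dual. (1) Inserting words gives operad structures on $\mathcal P_Q(n):=C_*(I^{n-1})$ and on $\mathcal P^Q(n):=C^*(I^{n-1})$: for cells $c=(c_1,\dots,c_m)$ of $I^m$ and $c'$ of $I^{n}$, $c\circ_i c'=(c_1,\dots,c_{i-1},c'_1,\dots,c'_n,c_i,\dots,c_m)$ for $1\le i\le m+1$, and in the same way on the dual bases. (2) $\mathcal P_Q$ is binary quadratic, generated by the three cells of $I$ in $\mathcal P_Q(2)=C_*(I)$, viewed as operations $\dashv,\vdash,\perp$, with a $9$-dimensional space of relations $R$ spanned by $$(x\circ y)\bullet z=x\circ(y\bullet z),\qquad \circ,\bullet\in\{\dashv,\vdash,\perp\}.$$ The operad $\mathcal P^Q$ is its Koszul dual: it is generated by the dual basis of the cells of $I$, with relations the orthogonal $R^\perp$ for the form in which the monomials $(x\circ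 y)\bullet z$ (of norm $+1$) and $x\circ(y\bullet z)$ (of norm $-1$) are orthogonal. (3) Call cubical trialgebra a vector space with three bilinear operations satisfying these $9$ relations. Algebras over $\mathcal P_Q$ and their morphisms are the cubical trialgebras and their morphisms, the operations being the actions of the three generators; the same holds for $\mathcal P^Q$. (4) $\mathcal P_Q$ and $\mathcal P^Q$ are Koszul operads: their Koszul complexes are acyclic, i.e. the only homology is the component $K$ of arity one, in degree one. (5) Both operads are filtered by the dimension of the cells. With $p(n,t)=\sum_{i\ge0}\dim\big(F^iP(n)/F^{i-1}P(n)\big)\,t^i$ (and $F^{-1}=0$), their generating series $\sum_{n\ge1}(-1)^n p(n,t)x^n\in\mathbb Z[t][[x]]$ are both equal to $$f_t(x)=\frac{-x}{1+(t+2)x},\qquad\text{and}\qquad f_t(f_t(x))=x.$$ -/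

import Mathlib

universe u v

/-! ### Non-symmetric operads

Operads are taken in vector spaces over a field `K`, without symmetric group actions and without
operations of arity zero.  To keep arities additive under partial composition, `op n` is the space
of operations of arity `n + 1`, and inputs are numbered from `0`. -/

/-- A non-symmetric operad `P` over `K`, presented by its unit and its partial compositions
`a ∘ᵢ b` (plug the output of `b` into the input number `i` of `a`); `op n` is `P(n + 1)`. -/
structure NSOperad (K : Type u) [Field K] where
  op : ℕ → Type u
  [addCommGroup : ∀ n, AddCommGroup (op n)]
  [module : ∀ n, Module K (op n)]
  /-- the identity operation, of arity one -/
  one : op 0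
  /-- `circ h i a b = a ∘ᵢ b`; the arities `m + 1` and `n + 1` give `(m + n) + 1`. -/
  circ : ∀ {m n p : ℕ}, m + n = p → Fin (m + 1) → (op m →ₗ[K] op n →ₗ[K] op p)
  one_circ : ∀ {n : ℕ} (i : Fin 1) (a : op n), circ (Nat.zero_add n) i one a = a
  circ_one : ∀ {m : ℕ} (i : Fin (m + 1)) (a : op m), circ (Nat.add_zero m) i a one = a
  /-- sequential composition: `(a ∘ᵢ b) ∘ᵢ₊ⱼ c = a ∘ᵢ (b ∘ⱼ c)` -/
  circ_seq : ∀ {m n l q s r : ℕ} (h₁ : m + n = q) (h₂ : q + l = r) (h₃ : n + l = s)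
    (h₄ : m + s = r) (i : Fin (m + 1)) (j : Fin (n + 1)) (k : Fin (q + 1)),
    (k : ℕ) = i + j → ∀ (a : op m) (b : op n) (c : op l),
    circ h₂ k (circ h₁ i a b) c = circ h₄ i a (circ h₃ j b c)
  /-- parallel composition: `(a ∘ᵢ b) ∘ⱼ₊ₙ c = (a ∘ⱼ c) ∘ᵢ b` for `i < j`,
  where `b` has arity `n + 1` -/
  circ_par : ∀ {m n l q s r : ℕ} (h₁ : m + n = q) (h₂ : q + l = r) (h₃ : m + l = s)
    (h₄ : s + n = r) (i j : Fin (m + 1)) (i' : Fin (s + 1)) (j' : Fin (q + 1)),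
    i < j → (i' : ℕ) = i → (j' : ℕ) = j + n → ∀ (a : op m) (b : op n) (c : op l),
    circ h₂ j' (circ h₁ i a b) c = circ h₄ i' (circ h₃ j a c) b

attribute [instance] NSOperad.addCommGroup NSOperad.module

namespace NSOperad

variable {K : Type u} [Field K]

/-- A morphism of non-symmetric operads. -/
@[ext]
structure Hom (P Q : NSOperad K) where
  app : ∀ n, P.op n →ₗ[K] Q.op n
  app_one : app 0 P.one = Q.one
  app_circ : ∀ {m n p : ℕ} (h : m + n = p) (i : Fin (m + 1)) (a : P.op m) (b : P.op n),
    app p (P.circ h i a b) = Q.circ h i (app m a) (app n b)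

/-- If `b` is an operation of arity `n + 1` with value `y` on the block of entries of `v` that
begins at place `i`, this is `v` with that block replaced by `y`. -/
def plug {A : Type v} {m n p : ℕ} (h : m + n = p) (i : Fin (m + 1)) (v : Fin (p + 1) → A)
    (b : (Fin (n + 1) → A) → A) : Fin (m + 1) → A := fun k =>
  if k < i then v ⟨k, by omega⟩
  else if k = i then b fun l => v ⟨i + l, by omega⟩
  else v ⟨k + n, by omega⟩

/-- A `P`-algebra structure on the vector space `A`: an action
`P(n + 1) ⊗ A^{⊗ (n + 1)} → A`, compatible with unit and compositions. -/
@[ext]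
structure Algebra (P : NSOperad K) (A : Type v) [AddCommGroup A] [Module K A] where
  act : ∀ n, P.op n →ₗ[K] MultilinearMap K (fun _ : Fin (n + 1) => A) A
  act_one : ∀ v : Fin 1 → A, act 0 P.one v = v 0
  act_circ : ∀ {m n p : ℕ} (h : m + n = p) (i : Fin (m + 1)) (a : P.op m) (b : P.op n)
    (v : Fin (p + 1) → A), act p (P.circ h i a b) v = act m a (plug h i v (act n b))

/-- A linear map that is a morphism of `P`-algebras. -/
def Algebra.IsHom {P : NSOperad K} {A B : Type v} [AddCommGroup A] [Module K A]
    [AddCommGroup B] [Module K B] (α : P.Algebra A) (β : P.Algebra B) (f : A →ₗ[K] B) : Prop :=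
  ∀ (n : ℕ) (a : P.op n) (v : Fin (n + 1) → A), f (α.act n a v) = β.act n a (fun k => f (v k))

/-! ### Binary quadratic operads and Koszul duality -/

/-- The space of quadratic expressions in binary generators indexed by `X`, that is the arity three
part of the free operad on `X`: a pair `(α, β)` stands for
`∑ α (x, y) • (x ∘₀ y) + ∑ β (x, y) • (x ∘₁ y)`. -/
abbrev Quad (K : Type u) (X : Type) : Type u := (X × X → K) × (X × X → K)

/-- The value in `P(3)` of a quadratic expression, for binary operations `g x` of `P`. -/
def evalQuad (P : NSOperad K) {X : Type} [Fintype X] (g : X → P.op 1) (r : Quad K X) : P.op 2 :=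
  ∑ w : X × X, r.1 w • P.circ rfl (0 : Fin 2) (g w.1) (g w.2) +
    ∑ w : X × X, r.2 w • P.circ rfl (1 : Fin 2) (g w.1) (g w.2)

/-- `P` is the operad generated by the binary operations `g x`, `x ∈ X`, subject to the quadratic
relations `R`, i.e. the quotient of the free operad on `X` by the ideal generated by `R`. -/
structure IsPresentedBy (P : NSOperad.{u} K) {X : Type} [Fintype X] (g : X → P.op 1)
    (R : Submodule K (Quad K X)) : Prop where
  relations : ∀ r ∈ R, P.evalQuad g r = 0
  universal : ∀ (Q : NSOperad.{u} K) (g' : X → Q.op 1), (∀ r ∈ R, Q.evalQuad g' r = 0) →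
    ∃! φ : Hom P Q, ∀ x, φ.app 1 (g x) = g' x

/-- The orthogonal of the space of relations, in terms of the dual basis of the generators, for the
pairing that makes the expressions `x ∘₀ y` (sign `+1`) and `x ∘₁ y` (sign `-1`) orthogonal. -/
def quadOrthogonal {X : Type} [Fintype X] (R : Submodule K (Quad K X)) :
    Submodule K (Quad K X) where
  carrier := {s | ∀ r ∈ R, ∑ w, r.1 w * s.1 w - ∑ w, r.2 w * s.2 w = 0}
  zero_mem' := by intro r _; simp
  add_mem' := by
    intro a b ha hb r hr
    have h1 := ha r hr
    have h2 := hb r hr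
    simp only [Prod.fst_add, Prod.snd_add, Pi.add_apply, mul_add, Finset.sum_add_distrib]
    linear_combination h1 + h2
  smul_mem' := by
    intro c a ha r hr
    have h1 := ha r hr
    simp only [Prod.smul_fst, Prod.smul_snd, Pi.smul_apply, smul_eq_mul, mul_left_comm _ c,
      ← Finset.mul_sum]
    linear_combination c * h1

/-- `Q` is the Koszul dual of the binary quadratic operad `P`: `P` is presented by the generators
`g x` with relations `R`, and `Q` by the dual generators `g' x` with the orthogonal relations. -/
structure IsKoszulDual (P Q : NSOperad.{u} K) {X : Type} [Fintype X] (g : X → P.op 1)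
    (g' : X → Q.op 1) (R : Submodule K (Quad K X)) : Prop where
  presented : P.IsPresentedBy g R
  presented_dual : Q.IsPresentedBy g' (quadOrthogonal R)

/-! ### The Koszul complex -/

/-- The underlying space `⨁ P(n)` of the free `P`-algebra on one generator. -/
abbrev FreeOne (P : NSOperad K) : Type u := DirectSum ℕ P.op

/-- The binary operation of the free `P`-algebra on one generator given by `x ∈ P(2)`:
`(a, b) ↦ x(a, b) = (x ∘₁ b) ∘₀ a`. -/
noncomputable def freeBin (P : NSOperad K) (x : P.op 1) :
    P.FreeOne →ₗ[K] P.FreeOne →ₗ[K] P.FreeOne :=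
  DirectSum.toModule K ℕ _ fun m => LinearMap.flip <| DirectSum.toModule K ℕ _ fun n =>
    ((P.circ (m := 1 + n) (n := m) rfl 0).comp (P.circ (m := 1) (n := n) rfl 1 x)).compr₂
      (DirectSum.lof K ℕ P.op (1 + n + m))

theorem merge_update {A : Type v} [AddCommGroup A] [Module K A] (μ : A →ₗ[K] A →ₗ[K] A) {k : ℕ}
    (i : Fin (k + 1)) [DecidableEq (Fin (k + 2))] (v : Fin (k + 2) → A) (l : Fin (k + 2)) :
    ∃ (l' : Fin (k + 1)) (φ : A →ₗ[K] A), ∀ x,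
      (fun j : Fin (k + 1) => if j < i then Function.update v l x j.castSucc
        else if j = i then μ (Function.update v l x i.castSucc) (Function.update v l x i.succ)
        else Function.update v l x j.succ) =
      Function.update (fun j : Fin (k + 1) => if j < i then v j.castSucc
        else if j = i then μ (v i.castSucc) (v i.succ) else v j.succ) l' (φ x) := by
  rcases lt_trichotomy l i.castSucc with hl | hl | hl
  · refine ⟨⟨l, by simp [Fin.lt_def] at hl; omega⟩, LinearMap.id, fun x => ?_⟩
    ext j
    simp only [Function.update_apply, Fin.ext_iff, Fin.lt_def, Fin.val_castSucc, Fin.val_succ,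
      LinearMap.id_apply] at hl ⊢
    split_ifs <;> first | rfl | omega
  · refine ⟨i, μ.flip (v i.succ), fun x => ?_⟩
    ext j
    simp only [Function.update_apply, Fin.ext_iff, Fin.lt_def, Fin.val_castSucc, Fin.val_succ,
      LinearMap.flip_apply] at hl ⊢
    split_ifs <;> first | rfl | omega
  · rcases eq_or_ne l i.succ with hl' | hl'
    · refine ⟨i, μ (v i.castSucc), fun x => ?_⟩
      ext j
      simp only [Function.update_apply, Fin.ext_iff, Fin.lt_def, Fin.val_castSucc, Fin.val_succ]
        at hl hl' ⊢
      split_ifs <;> first | rfl | omega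
    · refine ⟨⟨l - 1, by omega⟩, LinearMap.id, fun x => ?_⟩
      ext j
      simp only [Function.update_apply, Fin.ext_iff, Fin.lt_def, Fin.val_castSucc, Fin.val_succ,
        LinearMap.id_apply, ne_eq] at hl hl' ⊢
      split_ifs <;> first | rfl | omega

/-- `(a₀, …, aₖ₊₁) ↦ a₀ ⊗ ⋯ ⊗ μ(aᵢ, aᵢ₊₁) ⊗ ⋯ ⊗ aₖ₊₁`. -/
noncomputable def mergeMultilinear {A : Type v} [AddCommGroup A] [Module K A]
    (μ : A →ₗ[K] A →ₗ[K] A) {k : ℕ} (i : Fin (k + 1)) :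
    MultilinearMap K (fun _ : Fin (k + 2) => A) (PiTensorProduct K fun _ : Fin (k + 1) => A) :=
  MultilinearMap.mk'
    (fun v => PiTensorProduct.tprod K fun j : Fin (k + 1) =>
      if j < i then v j.castSucc else if j = i then μ (v i.castSucc) (v i.succ) else v j.succ)
    (by
      intro v l x y
      obtain ⟨l', h⟩ := merge_update μ i v l
      obtain ⟨φ, hφ⟩ := h
      simp only [hφ, map_add, MultilinearMap.map_update_add])
    (by
      intro v l c x
      obtain ⟨l', h⟩ := merge_update μ i v l
      obtain ⟨φ, hφ⟩ := h
      simp only [hφ, map_smul, MultilinearMap.map_update_smul])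

/-- The differential of the Koszul complex of a binary quadratic operad `P` with generators `g x`,
whose Koszul dual is `Q` with dual generators `g' x`.  The complex is the total space of
`P^¡ ∘ P`: in degree `k + 1` it is `Q(k + 1)^* ⊗ F^{⊗ (k + 1)}`, with `F` the free `P`-algebra on
one generator, and
`d(f ⊗ (a₀, …)) = ∑ᵢ (-1)ⁱ ∑ₓ f(- ∘ᵢ g' x) ⊗ (a₀, …, g x (aᵢ, aᵢ₊₁), …)`. -/
noncomputable def koszulD (P Q : NSOperad K) {X : Type} [Fintype X] (g : X → P.op 1)
    (g' : X → Q.op 1) (k : ℕ) :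
    TensorProduct K (Module.Dual K (Q.op (k + 1)))
        (PiTensorProduct K fun _ : Fin (k + 2) => P.FreeOne) →ₗ[K]
      TensorProduct K (Module.Dual K (Q.op k))
        (PiTensorProduct K fun _ : Fin (k + 1) => P.FreeOne) :=
  ∑ i : Fin (k + 1), (-1 : K) ^ (i : ℕ) • ∑ x : X,
    TensorProduct.map
      ((Q.circ (m := k) (n := 1) rfl i).flip (g' x)).dualMap
      (PiTensorProduct.lift (mergeMultilinear (P.freeBin (g x)) i))

/-- The augmentation of the Koszul complex: the projection of `Q(1)^* ⊗ F` to the summand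
`Q(1)^* ⊗ P(1)`, which is the arity one part of the complex. -/
noncomputable def koszulAug (P Q : NSOperad K) :
    TensorProduct K (Module.Dual K (Q.op 0))
        (PiTensorProduct K fun _ : Fin 1 => P.FreeOne) →ₗ[K]
      TensorProduct K (Module.Dual K (Q.op 0)) (P.op 0) :=
  TensorProduct.map LinearMap.id
    ((DirectSum.component K ℕ P.op 0).comp
      (PiTensorProduct.subsingletonEquiv (0 : Fin 1)).toLinearMap)

/-- The binary quadratic operad `P` is Koszul: its Koszul complex is acyclic, i.e. has no homology
except the arity one part `K · id` in degree one.  (For such a `P` the Koszul dual exists and the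
data below are unique up to isomorphism and change of basis of the generators.) -/
def IsKoszul (P : NSOperad.{u} K) : Prop :=
  ∃ (X : Type) (_ : Fintype X) (Q : NSOperad.{u} K) (g : X → P.op 1) (g' : X → Q.op 1)
    (R : Submodule K (Quad K X)), IsKoszulDual P Q g g' R ∧
    Function.Exact (koszulD P Q g g' 0) (koszulAug P Q) ∧
    ∀ k, Function.Exact (koszulD P Q g g' (k + 1)) (koszulD P Q g g' k)

/-! ### Filtrations and generating series -/

/-- `F` is an increasing exhaustive filtration of `P`, compatible with the operad structure;
`F n i` is the `i`-th step in arity `n + 1`. -/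
structure IsFiltration (P : NSOperad K) (F : ∀ n, ℕ → Submodule K (P.op n)) : Prop where
  mono : ∀ n, Monotone (F n)
  exhaustive : ∀ n, ∃ i, F n i = ⊤
  one_mem : P.one ∈ F 0 0
  circ_mem : ∀ {m n p : ℕ} (h : m + n = p) (i : Fin (m + 1)) (s t : ℕ), ∀ a ∈ F m s,
    ∀ b ∈ F n t, P.circ h i a b ∈ F p (s + t)

end NSOperad

/-- The Poincaré polynomial `∑ᵢ dim (Fⁱ / Fⁱ⁻¹) tⁱ` of a filtered vector space, with `F⁻¹ = 0`. -/
noncomputable def poincarePolynomial {K : Type u} [Field K] {M : Type v} [AddCommGroup M]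
    [Module K M] (F : ℕ → Submodule K M) : Polynomial ℤ :=
  ∑ᶠ i : ℕ, Polynomial.monomial i
    (Module.finrank K (F i ⧸ (if i = 0 then ⊥ else F (i - 1)).submoduleOf (F i)) : ℤ)

/-- The generating series `f_t(x) = ∑_{n ≥ 1} (-1)ⁿ p(n, t) xⁿ ∈ ℤ[t]⟦x⟧` of a filtered operad,
where `p(n, t)` is the Poincaré polynomial of `P(n)`. -/
noncomputable def NSOperad.genSeries {K : Type u} [Field K] {P : NSOperad K}
    (F : ∀ n, ℕ → Submodule K (P.op n)) : PowerSeries (Polynomial ℤ) :=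
  PowerSeries.mk fun n => match n with
    | 0 => 0
    | n + 1 => (-1) ^ (n + 1) * poincarePolynomial (F n)

/-! ### Hypercubes -/

/-- The three cells of the interval `I = [0, 1]`: the two end points and `I` itself.  They index
the left, right and middle operations of a cubical trialgebra. -/
inductive IntervalCell : Type
  | left | right | mid
  deriving DecidableEq

instance : Fintype IntervalCell where
  elems := {.left, .right, .mid}
  complete := by intro x; cases x <;> simp

/-- The cells of the hypercube `I^m`: products of `m` cells of the interval. -/
abbrev CubeCell (m : ℕ) : Type := Fin m → IntervalCell

/-- The dimension of a cell: the number of factors equal to the whole interval. -/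
def CubeCell.dim {m : ℕ} (c : CubeCell m) : ℕ := (Finset.univ.filter fun k => c k = .mid).card

/-- `C_*(I^m)`: the chain module of the hypercube, with the cells as basis. -/
abbrev CubeChain (K : Type u) [Field K] (m : ℕ) : Type u := CubeCell m →₀ K

/-- `C^*(I^m)`: the cochain module of the hypercube, dual to the chain module. -/
abbrev CubeCochain (K : Type u) [Field K] (m : ℕ) : Type u := Module.Dual K (CubeChain K m)

namespace CubeCell

/-- `(c₀, …, c_{i-1}, c'₀, …, c'_{n-1}, c_i, …, c_{m-1})`. -/
def insert {m n p : ℕ} (h : m + n = p) (i : Fin (m + 1)) (c : CubeCell m) (c' : CubeCell n) :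
    CubeCell p := fun k =>
  if h₁ : (k : ℕ) < i then c ⟨k, by omega⟩
  else if h₂ : (k : ℕ) < i + n then c' ⟨k - i, by omega⟩
  else c ⟨k - n, by omega⟩

/-- What remains of a cell of `I^{m+n}` when its `n` factors from place `i` on are removed. -/
def outer {m n p : ℕ} (h : m + n = p) (i : Fin (m + 1)) (c : CubeCell p) : CubeCell m := fun k =>
  if (k : ℕ) < i then c ⟨k, by omega⟩ else c ⟨k + n, by omega⟩

/-- The `n` factors from place `i` on of a cell of `I^{m+n}`. -/
def inner {m n p : ℕ} (h : m + n = p) (i : Fin (m + 1)) (c : CubeCell p) : CubeCell n := fun k =>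
  c ⟨i + k, by omega⟩

theorem insert_seq {m n l q s r : ℕ} (h₁ : m + n = q) (h₂ : q + l = r) (h₃ : n + l = s)
    (h₄ : m + s = r) (i : Fin (m + 1)) (j : Fin (n + 1)) (k : Fin (q + 1)) (hk : (k : ℕ) = i + j)
    (a : CubeCell m) (b : CubeCell n) (c : CubeCell l) :
    insert h₂ k (insert h₁ i a b) c = insert h₄ i a (insert h₃ j b c) := by
  ext x
  simp only [insert]
  split_ifs <;> first | omega | exact congrArg _ (Fin.ext (by simp <;> omega))

theorem insert_par {m n l q s r : ℕ} (h₁ : m + n = q) (h₂ : q + l = r) (h₃ : m + l = s)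
    (h₄ : s + n = r) (i j : Fin (m + 1)) (i' : Fin (s + 1)) (j' : Fin (q + 1)) (hij : i < j)
    (hi : (i' : ℕ) = i) (hj : (j' : ℕ) = j + n)
    (a : CubeCell m) (b : CubeCell n) (c : CubeCell l) :
    insert h₂ j' (insert h₁ i a b) c = insert h₄ i' (insert h₃ j a c) b := by
  rw [Fin.lt_def] at hij
  ext x
  simp only [insert]
  split_ifs <;> first | omega | exact congrArg _ (Fin.ext (by simp <;> omega))

end CubeCell

section

variable (K : Type u) [Field K]

/-- Partial composition of chains of hypercubes: the bilinear extension of insertion of cells. -/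
noncomputable def cubeChainCirc {m n p : ℕ} (h : m + n = p) (i : Fin (m + 1)) :
    CubeChain K m →ₗ[K] CubeChain K n →ₗ[K] CubeChain K p :=
  Finsupp.lsum K fun c =>
    LinearMap.toSpanSingleton K _ (Finsupp.lmapDomain K K (CubeCell.insert h i c))

theorem cubeChainCirc_single {m n p : ℕ} (h : m + n = p) (i : Fin (m + 1)) (c : CubeCell m)
    (c' : CubeCell n) (x y : K) :
    cubeChainCirc K h i (Finsupp.single c x) (Finsupp.single c' y) =
      Finsupp.single (CubeCell.insert h i c c') (x * y) := by
  simp [cubeChainCirc]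

/-- Partial composition of cochains of hypercubes: `(f ∘ᵢ f')(c) = f(outer c) f'(inner c)`.
It is dual to cutting a block out of a cell; on the dual basis of the cells it is insertion. -/
noncomputable def cubeCochainCirc {m n p : ℕ} (h : m + n = p) (i : Fin (m + 1)) :
    CubeCochain K m →ₗ[K] CubeCochain K n →ₗ[K] CubeCochain K p :=
  LinearMap.mk₂ K
    (fun f f' => Finsupp.linearCombination K fun c : CubeCell p =>
      f (Finsupp.single (c.outer h i) 1) * f' (Finsupp.single (c.inner h i) 1))
    (by intros; ext; simp [add_mul])
    (by intros; ext; simp [mul_assoc])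
    (by intros; ext; simp [mul_add])
    (by intros; ext; simp [mul_left_comm])

theorem cubeCochainCirc_single {m n p : ℕ} (h : m + n = p) (i : Fin (m + 1))
    (f : CubeCochain K m) (f' : CubeCochain K n) (c : CubeCell p) :
    cubeCochainCirc K h i f f' (Finsupp.single c 1) =
      f (Finsupp.single (c.outer h i) 1) * f' (Finsupp.single (c.inner h i) 1) := by
  simp [cubeCochainCirc]

/-- The operad `P_Q(n) = C_*(I^{n-1})` of chain modules of the hypercubes. -/
noncomputable def cubeChainOperad : NSOperad K where
  op n := CubeChain K n
  one := Finsupp.single Fin.elim0 1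
  circ h i := cubeChainCirc K h i
  one_circ := by
    intro n i a
    induction a using Finsupp.induction_linear with
    | zero => simp
    | add a b ha hb => rw [map_add, ha, hb]
    | single c x =>
      rw [cubeChainCirc_single, one_mul]
      congr 1
      ext k
      simp only [CubeCell.insert]
      split_ifs <;> first | omega | exact congrArg _ (Fin.ext (by simp <;> omega))
  circ_one := by
    intro m i a
    induction a using Finsupp.induction_linear with
    | zero => simp
    | add a b ha hb => rw [map_add, LinearMap.add_apply, ha, hb]
    | single c x =>
      rw [cubeChainCirc_single, mul_one]
      congr 1
      ext k
      simp only [CubeCell.insert]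
      split_ifs <;> first | omega | (congr 1)
  circ_seq := by
    intro m n l q s r h₁ h₂ h₃ h₄ i j k hk a b c
    induction a using Finsupp.induction_linear with
    | zero => simp
    | add a a' ha ha' => simp only [map_add, LinearMap.add_apply, ha, ha']
    | single a x =>
      induction b using Finsupp.induction_linear with
      | zero => simp
      | add b b' hb hb' => simp only [map_add, LinearMap.add_apply, hb, hb']
      | single b y =>
        induction c using Finsupp.induction_linear with
        | zero => simp
        | add c c' hc hc' => simp only [map_add, hc, hc']
        | single c z =>
          simp only [cubeChainCirc_single, mul_assoc]
          rw [CubeCell.insert_seq h₁ h₂ h₃ h₄ i j k hk]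
  circ_par := by
    intro m n l q s r h₁ h₂ h₃ h₄ i j i' j' hij hi hj a b c
    induction a using Finsupp.induction_linear with
    | zero => simp
    | add a a' ha ha' => simp only [map_add, LinearMap.add_apply, ha, ha']
    | single a x =>
      induction b using Finsupp.induction_linear with
      | zero => simp
      | add b b' hb hb' => simp only [map_add, LinearMap.add_apply, hb, hb']
      | single b y =>
        induction c using Finsupp.induction_linear with
        | zero => simp
        | add c c' hc hc' => simp only [map_add, LinearMap.add_apply, hc, hc']
        | single c z =>
          simp only [cubeChainCirc_single]
          rw [CubeCell.insert_par h₁ h₂ h₃ h₄ i j i' j' hij hi hj, mul_right_comm]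

/-- The operad `P^Q(n) = C^*(I^{n-1})` of cochain modules of the hypercubes. -/
noncomputable def cubeCochainOperad : NSOperad K where
  op n := CubeCochain K n
  one := Finsupp.lapply Fin.elim0
  circ h i := cubeCochainCirc K h i
  one_circ := by
    intro n i a
    refine Finsupp.lhom_ext' fun c => LinearMap.ext_ring ?_
    simp only [LinearMap.comp_apply, Finsupp.lsingle_apply, cubeCochainCirc_single]
    have h1 : CubeCell.outer (Nat.zero_add n) i c = Fin.elim0 := Subsingleton.elim _ _
    have h2 : CubeCell.inner (Nat.zero_add n) i c = c := by
      ext k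
      simp only [CubeCell.inner]
      congr 1; ext; simp only; omega
    rw [h1, h2]
    simp
  circ_one := by
    intro n i a
    refine Finsupp.lhom_ext' fun c => LinearMap.ext_ring ?_
    simp only [LinearMap.comp_apply, Finsupp.lsingle_apply, cubeCochainCirc_single]
    have h1 : CubeCell.outer (Nat.add_zero n) i c = c := by
      ext k
      simp [CubeCell.outer]
    have h2 : CubeCell.inner (Nat.add_zero n) i c = Fin.elim0 := Subsingleton.elim _ _
    rw [h1, h2]
    simp
  circ_seq := by
    intro m n l q s r h₁ h₂ h₃ h₄ i j k hk a b c
    refine Finsupp.lhom_ext' fun w => LinearMap.ext_ring ?_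
    simp only [LinearMap.comp_apply, Finsupp.lsingle_apply, cubeCochainCirc_single, mul_assoc]
    rw [show CubeCell.outer h₁ i (CubeCell.outer h₂ k w) = CubeCell.outer h₄ i w from ?_,
      show CubeCell.inner h₁ i (CubeCell.outer h₂ k w) =
        CubeCell.outer h₃ j (CubeCell.inner h₄ i w) from ?_,
      show CubeCell.inner h₂ k w = CubeCell.inner h₃ j (CubeCell.inner h₄ i w) from ?_]
    all_goals
      ext x
      simp only [CubeCell.outer, CubeCell.inner]
      try split_ifs
    all_goals first | omega | exact congrArg w (Fin.ext (by simp <;> omega))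
  circ_par := by
    intro m n l q s r h₁ h₂ h₃ h₄ i j i' j' hij hi hj a b c
    rw [Fin.lt_def] at hij
    refine Finsupp.lhom_ext' fun w => LinearMap.ext_ring ?_
    simp only [LinearMap.comp_apply, Finsupp.lsingle_apply, cubeCochainCirc_single]
    rw [show CubeCell.outer h₁ i (CubeCell.outer h₂ j' w) =
        CubeCell.outer h₃ j (CubeCell.outer h₄ i' w) from ?_,
      show CubeCell.inner h₁ i (CubeCell.outer h₂ j' w) = CubeCell.inner h₄ i' w from ?_,
      show CubeCell.inner h₂ j' w = CubeCell.inner h₃ j (CubeCell.outer h₄ i' w) from ?_,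
      mul_right_comm]
    all_goals
      ext x
      simp only [CubeCell.outer, CubeCell.inner]
      try split_ifs
    all_goals first | omega | exact congrArg w (Fin.ext (by simp <;> omega))

/-- The generating operations of the chain operad: the cells of the interval. -/
noncomputable def chainGen (s : IntervalCell) : (cubeChainOperad K).op 1 :=
  (Finsupp.single (fun _ => s) 1 : CubeChain K 1)

/-- The generating operations of the cochain operad: the dual basis of the cells of the interval. -/
noncomputable def cochainGen (s : IntervalCell) : (cubeCochainOperad K).op 1 :=
  (Finsupp.lapply (fun _ => s) : CubeCochain K 1)

/-- The filtration of the chains by the dimension of the cells. -/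
noncomputable def chainFiltration (n i : ℕ) : Submodule K ((cubeChainOperad K).op n) :=
  (Finsupp.supported K K {c : CubeCell n | c.dim ≤ i} : Submodule K (CubeChain K n))

/-- The filtration of the cochains by the dimension of the cells: the cochains that vanish on all
cells of dimension `> i`. -/
noncomputable def cochainFiltration (n i : ℕ) : Submodule K ((cubeCochainOperad K).op n) :=
  ((Finsupp.supported K K {c : CubeCell n | i < c.dim}).dualAnnihilator :
    Submodule K (CubeCochain K n))

/-- The relations `(x ∘ₛ y) ∘ₜ z = x ∘ₛ (y ∘ₜ z)`, one for each pair `s, t` of operations, as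
quadratic expressions `t ∘₀ s - s ∘₁ t`. -/
noncomputable def cubicalRelations : Submodule K (NSOperad.Quad K IntervalCell) :=
  Submodule.span K (Set.range fun st : IntervalCell × IntervalCell =>
    ((Pi.single (st.2, st.1) 1, -Pi.single (st.1, st.2) 1) : NSOperad.Quad K IntervalCell))

/-- A cubical trialgebra: a vector space with three bilinear operations (left, right and middle)
and the nine relations `(x ∘ₛ y) ∘ₜ z = x ∘ₛ (y ∘ₜ z)`. -/
@[ext]
structure CubicalTrialgebra (A : Type v) [AddCommGroup A] [Module K A] where
  bin : IntervalCell → A →ₗ[K] A →ₗ[K] A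
  assoc : ∀ (s t : IntervalCell) (x y z : A), bin t (bin s x y) z = bin s x (bin t y z)

end

variable {K : Type u} [Field K]

/-- The operations of the trialgebra are the actions of the generators `g s` of `P`. -/
def CubicalTrialgebra.Induces {P : NSOperad K} (g : IntervalCell → P.op 1) {A : Type v}
    [AddCommGroup A] [Module K A] (α : P.Algebra A) (T : CubicalTrialgebra K A) : Prop :=
  ∀ (s : IntervalCell) (x y : A), α.act 1 (g s) ![x, y] = T.bin s x y

/-- A linear map that is a morphism of cubical trialgebras. -/
def CubicalTrialgebra.IsHom {A B : Type v} [AddCommGroup A] [Module K A] [AddCommGroup B]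
    [Module K B] (S : CubicalTrialgebra K A) (T : CubicalTrialgebra K B) (f : A →ₗ[K] B) : Prop :=
  ∀ (s : IntervalCell) (x y : A), f (S.bin s x y) = T.bin s (f x) (f y)

/-- The category of `P`-algebras is that of cubical trialgebras, the three operations being the
actions of the elements `g s` of `P(2)`. -/
structure AlgebrasAreCubical (P : NSOperad.{u} K) (g : IntervalCell → P.op 1) : Prop where
  trialgebra : ∀ (A : Type v) [AddCommGroup A] [Module K A] (α : P.Algebra A),
    ∃! T : CubicalTrialgebra K A, T.Induces g α
  algebra : ∀ (A : Type v) [AddCommGroup A] [Module K A] (T : CubicalTrialgebra K A),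
    ∃! α : P.Algebra A, T.Induces g α
  hom : ∀ (A B : Type v) [AddCommGroup A] [Module K A] [AddCommGroup B] [Module K B]
    (α : P.Algebra A) (β : P.Algebra B) (S : CubicalTrialgebra K A) (T : CubicalTrialgebra K B),
    S.Induces g α → T.Induces g β → ∀ f : A →ₗ[K] B, α.IsHom β f ↔ S.IsHom T f

/-! ### Partial composition structures without linear structure -/

/-! Both operads carry a basis of words composed by insertion (`cubeChainBasis`, `cubeCochainBasis`;
for cochains it is the dual basis). All statements except those on the filtrations are proved once,
for any operad with such a `CubeBasis`.

Presentation and algebras: the relations `g t ∘₀ g s = g s ∘₁ g t` turn every composite of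
generators into a right comb, which is determined by the word of its letters. The key lemma
`wordOp_circ` shows, in any operad in sets with these relations, that combs compose by insertion. In
a linear operad this gives the morphism required by the presentation; in the operad of all maps `A ^
(n + 1) → A` it gives the algebra defined by a cubical trialgebra. Uniqueness holds because the
generators generate (`basis_succ`). For the signed pairing, the relations are their own orthogonal
(`quadOrthogonal_cubicalRelations`), so any two operads with a cube basis are Koszul dual to each
other.

Koszulness: a basis of the Koszul complex consists of words with some letters marked. A dual basis
element of the Koszul dual gives the marked letters, and the tensor factors in the free algebra give
the blocks between them. The differential is the alternating sum of the removals of one mark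
(`isFaceDifferential_koszulD`). For a fixed underlying word this is the augmented chain complex of
the simplex on its letters, contracted by the cone on the first letter (`d_homotopy_add`). Only the
empty word survives.

Series: dimension counts the letters `mid`, so it is additive under insertion, and `∑ t ^ dim = (t +
2) ^ n` over the words of length `n`. The involution follows formally from `f (1 + (t + 2) x) = -x`.
-/

/-- A non-symmetric operad in sets, with the arity conventions of `NSOperad`. -/
structure SetOperad (O : ℕ → Type v) where
  one : O 0
  circ : ∀ {m n p : ℕ}, m + n = p → Fin (m + 1) → O m → O n → O p
  one_circ : ∀ {n : ℕ} (i : Fin 1) (a : O n), circ (Nat.zero_add n) i one a = a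
  circ_one : ∀ {m : ℕ} (i : Fin (m + 1)) (a : O m), circ (Nat.add_zero m) i a one = a
  circ_seq : ∀ {m n l q s r : ℕ} (h₁ : m + n = q) (h₂ : q + l = r) (h₃ : n + l = s)
    (h₄ : m + s = r) (i : Fin (m + 1)) (j : Fin (n + 1)) (k : Fin (q + 1)),
    (k : ℕ) = i + j → ∀ (a : O m) (b : O n) (c : O l),
    circ h₂ k (circ h₁ i a b) c = circ h₄ i a (circ h₃ j b c)
  circ_par : ∀ {m n l q s r : ℕ} (h₁ : m + n = q) (h₂ : q + l = r) (h₃ : m + l = s)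
    (h₄ : s + n = r) (i j : Fin (m + 1)) (i' : Fin (s + 1)) (j' : Fin (q + 1)),
    i < j → (i' : ℕ) = i → (j' : ℕ) = j + n → ∀ (a : O m) (b : O n) (c : O l),
    circ h₂ j' (circ h₁ i a b) c = circ h₄ i' (circ h₃ j a c) b

namespace SetOperad

variable {O : ℕ → Type v} (S : SetOperad O) (g : IntervalCell → O 1)

/-- The right-bracketed composite of the binary operations named by the letters of a word. -/
def wordOp : ∀ n, CubeCell n → O n
  | 0, _ => S.one
  | n + 1, c => S.circ (Nat.add_comm 1 n) 1 (g (c 0)) (wordOp n (Fin.tail c))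

theorem wordOp_succ (n : ℕ) (c : CubeCell (n + 1)) :
    S.wordOp g (n + 1) c = S.circ (Nat.add_comm 1 n) 1 (g (c 0)) (S.wordOp g n (Fin.tail c)) :=
  rfl

theorem wordOp_one (s : IntervalCell) : S.wordOp g 1 (fun _ => s) = g s := by
  rw [wordOp_succ]
  exact S.circ_one (m := 1) 1 (g s)

/-- The quadratic relations `g t ∘₀ g s = g s ∘₁ g t`. -/
def QuadAssoc : Prop :=
  ∀ s t, S.circ (rfl : 1 + 1 = 2) 0 (g t) (g s) = S.circ (rfl : 1 + 1 = 2) 1 (g s) (g t)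

variable {g}

/-- One relation moves `t` past the first letter `s`: `t ∘₀ (s ∘₁ w) = (t ∘₀ s) ∘₁ w = (s ∘₁ t) ∘₁ w
= s ∘₁ (t ∘₀ w)`. Repeating this carries `t` to the end of the word. -/
theorem gen_circ_wordOp (hg : S.QuadAssoc g) (t : IntervalCell) :
    ∀ (n p : ℕ) (h : 1 + n = p) (h' : n + 1 = p) (c : CubeCell n),
      S.circ h 0 (g t) (S.wordOp g n c) =
        S.wordOp g p (CubeCell.insert h' (Fin.last n) c fun _ => t)
  | 0, p, h, h', c => by
    obtain rfl : p = 1 := h.symm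
    rw [show CubeCell.insert h' (Fin.last 0) c (fun _ => t) = fun _ => t by
      ext k; simp [CubeCell.insert], wordOp_one]
    exact S.circ_one (m := 1) 0 (g t)
  | n + 1, p, h, h', c => by
    obtain rfl : p = n + 1 + 1 := h'.symm
    rw [wordOp_succ, wordOp_succ,
      ← S.circ_seq rfl (by omega) (Nat.add_comm 1 n) h 0 1 1 rfl, hg,
      S.circ_seq rfl (by omega) (Nat.add_comm 1 n) (Nat.add_comm 1 (n + 1)) 1 0 1 rfl,
      gen_circ_wordOp hg t n (n + 1) (Nat.add_comm 1 n) rfl]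
    congr 2
    ext k
    simp only [CubeCell.insert, Fin.tail, Fin.val_last, Fin.val_succ]
    split_ifs <;> first | omega | rfl

/-- Grafting a right comb on the last input of another yields a right comb by sequential
associativity alone; the quadratic relations play no role. -/
theorem wordOp_circ_last (n : ℕ) :
    ∀ (m p : ℕ) (h : m + n = p) (i : Fin (m + 1)) (c : CubeCell m) (c' : CubeCell n),
      (i : ℕ) = m →
      S.circ h i (S.wordOp g m c) (S.wordOp g n c') = S.wordOp g p (CubeCell.insert h i c c')
  | 0, p, h, i, c, c', hi => by
    obtain rfl : p = n := by omega
    rw [show CubeCell.insert h i c c' = c' by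
      ext k
      simp only [CubeCell.insert]
      split_ifs <;> first | omega | exact congrArg _ (Fin.ext (by simp))]
    exact S.one_circ i _
  | m + 1, p, h, i, c, c', hi => by
    obtain rfl : p = m + n + 1 := by omega
    obtain ⟨i, rfl⟩ := Fin.exists_succ_eq.2 (show i ≠ 0 from fun h => by simp [h] at hi)
    rw [wordOp_succ, wordOp_succ,
      S.circ_seq (Nat.add_comm 1 m) h rfl (Nat.add_comm 1 (m + n)) 1 i i.succ
        (by simp; omega), wordOp_circ_last n m (m + n) rfl i _ _ (by simpa using hi)]
    congr 2
    ext k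
    simp only [CubeCell.insert, Fin.tail, Fin.val_succ]
    split_ifs <;> first | omega | exact congrArg _ (Fin.ext (by simp <;> omega))

/-- Under the quadratic relations, composition of words is insertion. -/
theorem wordOp_circ (hg : S.QuadAssoc g) (n : ℕ) :
    ∀ (m p : ℕ) (h : m + n = p) (i : Fin (m + 1)) (c : CubeCell m) (c' : CubeCell n),
      S.circ h i (S.wordOp g m c) (S.wordOp g n c') = S.wordOp g p (CubeCell.insert h i c c')
  | 0, p, h, i, c, c' => S.wordOp_circ_last n 0 p h i c c' (by omega)
  | m + 1, p, h, i, c, c' => by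
    obtain rfl : p = m + n + 1 := by omega
    rcases Fin.eq_zero_or_eq_succ i with rfl | ⟨i, rfl⟩
    -- At the first input, parallel composition grafts the inner word on the first letter before the
    -- tail is attached. `gen_circ_wordOp` then moves that letter behind the inner word, and the
    -- tail is appended at the last input.
    · rw [wordOp_succ, ← S.circ_par (q := n + 1) (by omega) (by omega) (Nat.add_comm 1 m) h 0 1 0
        (Fin.last (n + 1)) (by simp) rfl (by simp; omega),
        S.gen_circ_wordOp hg _ n (n + 1) _ rfl, S.wordOp_circ_last m _ _ _ _ _ _ rfl]
      congr 1
      ext k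
      simp only [CubeCell.insert, Fin.tail, Fin.val_last, Fin.val_zero, not_lt_zero, dite_false,
        zero_add, tsub_zero]
      split_ifs <;> first | omega | exact congrArg _ (Fin.ext (by simp <;> omega))
    · rw [wordOp_succ, wordOp_succ,
        S.circ_seq (Nat.add_comm 1 m) h rfl (Nat.add_comm 1 (m + n)) 1 i i.succ
        (by simp; omega), wordOp_circ hg n m (m + n) rfl i _]
      congr 2
      ext k
      simp only [CubeCell.insert, Fin.tail, Fin.val_succ]
      split_ifs <;> first | omega | exact congrArg _ (Fin.ext (by simp <;> omega))

end SetOperad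

/-! ### Operads with a basis of cells composed by insertion -/

section

variable {K : Type u} [Field K]

/-- A basis of `P` indexed by the cells of the hypercubes, in which composition is insertion. -/
structure NSOperad.CubeBasis (P : NSOperad K) where
  basis : ∀ n, Module.Basis (CubeCell n) K (P.op n)
  one : basis 0 Fin.elim0 = P.one
  circ : ∀ {m n p : ℕ} (h : m + n = p) (i : Fin (m + 1)) (c : CubeCell m) (c' : CubeCell n),
    P.circ h i (basis m c) (basis n c') = basis p (CubeCell.insert h i c c')

/-- The cells as a basis of the chain operad. -/
noncomputable def cubeChainBasis (K : Type u) [Field K] : (cubeChainOperad K).CubeBasis where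
  basis n := (Finsupp.basisSingleOne : Module.Basis (CubeCell n) K (CubeChain K n))
  one := congrFun Finsupp.coe_basisSingleOne _
  circ {m n p} h i c c' := by
    change cubeChainCirc K h i (Finsupp.basisSingleOne c : CubeChain K m)
      (Finsupp.basisSingleOne c' : CubeChain K n) = (Finsupp.basisSingleOne _ : CubeChain K p)
    simp only [Finsupp.coe_basisSingleOne]
    exact (cubeChainCirc_single K h i c c' 1 1).trans (by rw [one_mul])

/-- Cutting a block out of a word and inserting one are inverse to each other. This is why the dual
basis of the cells is also composed by insertion. -/
theorem CubeCell.eq_insert_iff {m n p : ℕ} (h : m + n = p) (i : Fin (m + 1)) (w : CubeCell p)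
    (c : CubeCell m) (c' : CubeCell n) :
    w = insert h i c c' ↔ w.outer h i = c ∧ w.inner h i = c' := by
  constructor
  · rintro rfl
    constructor <;> ext k <;> simp only [outer, inner, insert] <;> split_ifs <;>
      first | omega | exact congrArg _ (Fin.ext (by simp))
  · rintro ⟨rfl, rfl⟩
    ext k
    simp only [outer, inner, insert]
    split_ifs <;> first | omega | exact congrArg _ (Fin.ext (by simp <;> omega))

theorem dualBasis_cell_apply {m : ℕ} (c w : CubeCell m) :
    (Finsupp.basisSingleOne : Module.Basis (CubeCell m) K (CubeChain K m)).dualBasis c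
      (Finsupp.single w 1) = if w = c then 1 else 0 := by
  rw [Module.Basis.dualBasis_apply, Finsupp.basisSingleOne_repr, LinearEquiv.refl_apply,
    Finsupp.single_apply]

/-- The dual basis of the cells as a basis of the cochain operad. -/
noncomputable def cubeCochainBasis (K : Type u) [Field K] : (cubeCochainOperad K).CubeBasis where
  basis n := ((Finsupp.basisSingleOne : Module.Basis (CubeCell n) K (CubeChain K n)).dualBasis :
    Module.Basis (CubeCell n) K (CubeCochain K n))
  one := by
    refine Finsupp.lhom_ext' fun c => LinearMap.ext_ring ?_
    refine (dualBasis_cell_apply _ c).trans ?_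
    rw [if_pos (Subsingleton.elim _ _)]
    exact ((Finsupp.single_apply).trans (if_pos (Subsingleton.elim _ _))).symm
  circ {m n p} h i c c' := by
    refine Finsupp.lhom_ext' fun w => LinearMap.ext_ring ?_
    refine (cubeCochainCirc_single K h i _ _ w).trans ?_
    refine Eq.trans ?_ (dualBasis_cell_apply _ w).symm
    refine (congrArg₂ (· * ·) (dualBasis_cell_apply c _) (dualBasis_cell_apply c' _)).trans ?_
    simp only [CubeCell.eq_insert_iff h i w c c']
    split_ifs <;> simp_all

theorem cubeChainBasis_gen (s : IntervalCell) :
    (cubeChainBasis K).basis 1 (fun _ => s) = chainGen K s :=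
  congrFun Finsupp.coe_basisSingleOne _

theorem cubeCochainBasis_gen (s : IntervalCell) :
    (cubeCochainBasis K).basis 1 (fun _ => s) = cochainGen K s := by
  refine Finsupp.lhom_ext' fun w => LinearMap.ext_ring ?_
  exact (dualBasis_cell_apply _ w).trans Finsupp.single_apply.symm

/-! ### Quadratic relations: evaluation, self-orthogonality, dimension. -/

namespace NSOperad

/-- The operad in sets underlying a linear operad. -/
def toSetOperad (P : NSOperad K) : SetOperad P.op where
  one := P.one
  circ h i a b := P.circ h i a b
  one_circ := P.one_circ
  circ_one := P.circ_one
  circ_seq := P.circ_seq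
  circ_par := P.circ_par

/-- The quadratic expression `t ∘₀ s - s ∘₁ t`. -/
noncomputable def cubicalRelation (K : Type u) [Field K] (st : IntervalCell × IntervalCell) :
    Quad K IntervalCell :=
  (Pi.single (st.2, st.1) 1, -Pi.single (st.1, st.2) 1)

theorem evalQuad_cubicalRelation (P : NSOperad K) (g : IntervalCell → P.op 1)
    (st : IntervalCell × IntervalCell) :
    P.evalQuad g (cubicalRelation K st) =
      P.circ rfl (0 : Fin 2) (g st.2) (g st.1) - P.circ rfl (1 : Fin 2) (g st.1) (g st.2) := by
  simp only [evalQuad, cubicalRelation, Pi.single_apply, Pi.neg_apply, ite_smul, neg_smul,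
    one_smul, zero_smul, Finset.sum_neg_distrib, Finset.sum_ite_eq', Finset.mem_univ, if_true,
    sub_eq_add_neg]

/-- Evaluation of quadratic expressions, as a linear map. -/
noncomputable def evalQuadLinear (P : NSOperad K) (g : IntervalCell → P.op 1) :
    Quad K IntervalCell →ₗ[K] P.op 2 where
  toFun := P.evalQuad g
  map_add' r s := by
    simp only [evalQuad, Prod.fst_add, Prod.snd_add, Pi.add_apply, add_smul,
      Finset.sum_add_distrib]
    abel
  map_smul' c r := by
    simp only [evalQuad, Prod.smul_fst, Prod.smul_snd, Pi.smul_apply, smul_assoc, smul_add,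
      Finset.smul_sum, RingHom.id_apply]

theorem evalQuad_cubicalRelations_iff (P : NSOperad K) (g : IntervalCell → P.op 1) :
    (∀ r ∈ cubicalRelations K, P.evalQuad g r = 0) ↔ P.toSetOperad.QuadAssoc g := by
  constructor
  · intro h s t
    exact sub_eq_zero.1 ((P.evalQuad_cubicalRelation g (s, t)).symm.trans
      (h _ (Submodule.subset_span ⟨(s, t), rfl⟩)))
  · intro h
    have : cubicalRelations K ≤ LinearMap.ker (P.evalQuadLinear g) := by
      refine Submodule.span_le.2 ?_
      rintro _ ⟨st, rfl⟩
      exact (P.evalQuad_cubicalRelation g st).trans (sub_eq_zero.2 (h st.1 st.2))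
    exact fun r hr => this hr

/-- Each relation has one monomial of norm `+1` and one of norm `-1`, so it is isotropic, and
distinct relations share no monomial. Conversely, pairing with the relations forces the second
component of an orthogonal element to be minus the swap of the first, which makes it a combination
of the relations. -/
theorem quadOrthogonal_cubicalRelations :
    quadOrthogonal (cubicalRelations K) = cubicalRelations K := by
  apply le_antisymm
  · intro s hs
    have h : ∀ st : IntervalCell × IntervalCell, s.2 st = - s.1 st.swap := by
      intro st
      have := hs (cubicalRelation K st) (Submodule.subset_span ⟨st, rfl⟩)
      simp only [cubicalRelation, Pi.single_apply, Pi.neg_apply, ite_mul, neg_mul, one_mul,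
        zero_mul, Finset.sum_neg_distrib, Finset.sum_ite_eq', Finset.mem_univ, if_true,
        sub_neg_eq_add] at this
      exact eq_neg_of_add_eq_zero_right this
    have key : s = ∑ st : IntervalCell × IntervalCell, s.1 st.swap • cubicalRelation K st := by
      refine Prod.ext ?_ ?_
      · ext w
        simp only [Prod.fst_sum, Finset.sum_apply, Prod.smul_fst, cubicalRelation, Pi.smul_apply,
          smul_eq_mul]
        rw [Finset.sum_eq_single w.swap]
        · simp
        · intro b _ hb
          rw [Pi.single_eq_of_ne, mul_zero]
          rintro rfl
          exact hb rfl
        · simp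
      · ext w
        simp [Prod.snd_sum, cubicalRelation, Pi.single_apply, h]
    rw [key]
    exact Submodule.sum_mem _ fun st _ =>
      Submodule.smul_mem _ _ (Submodule.subset_span ⟨st, rfl⟩)
  · refine Submodule.span_le.2 ?_
    rintro _ ⟨st, rfl⟩ r hr
    induction hr using Submodule.span_induction with
    | mem x hx =>
      obtain ⟨uv, rfl⟩ := hx
      simp only [Pi.single_apply, Pi.neg_apply, mul_ite, mul_one, mul_zero, mul_neg,
        Finset.sum_ite_eq', Finset.sum_neg_distrib, Finset.mem_univ, if_true, Prod.mk.injEq,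
        neg_neg]
      simp [and_comm]
    | zero => simp
    | add a b _ _ ha hb =>
      simp only [Prod.fst_add, Prod.snd_add, Pi.add_apply, add_mul, Finset.sum_add_distrib]
      linear_combination ha + hb
    | smul c a _ ha =>
      simp only [Prod.smul_fst, Prod.smul_snd, Pi.smul_apply, smul_eq_mul, mul_assoc,
        ← Finset.mul_sum]
      linear_combination c * ha

theorem finrank_cubicalRelations : Module.finrank K (cubicalRelations K) = 9 := by
  have h : LinearIndependent K (cubicalRelation K) := by
    -- The first components alone are the standard basis vectors, permuted by the swap.
    refine LinearIndependent.of_comp (LinearMap.fst K _ _) ?_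
    have := (Pi.basisFun K (IntervalCell × IntervalCell)).linearIndependent.comp Prod.swap
      Prod.swap_injective
    convert this using 1
    ext st
    simp [cubicalRelation]
    rfl
  exact (finrank_span_eq_card h).trans rfl

/-! ### Presentation of an operad with a cube basis. -/

namespace CubeBasis

variable {P : NSOperad K} (B : P.CubeBasis)

/-- The generating binary operations: the cells of the interval. -/
noncomputable def gen (s : IntervalCell) : P.op 1 := B.basis 1 fun _ => s

/-- Both sides are the two-letter word `s t`. -/
theorem quadAssoc_gen : P.toSetOperad.QuadAssoc B.gen := by
  intro s t
  refine (B.circ rfl 0 _ _).trans (Eq.trans ?_ (B.circ rfl 1 _ _).symm)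
  congr 1
  ext k
  fin_cases k <;> rfl

/-- Every basis element is thus a right comb of generators, so morphisms and actions are determined
by their values on the generators. -/
theorem basis_succ (n : ℕ) (c : CubeCell (n + 1)) :
    B.basis (n + 1) c = P.circ (Nat.add_comm 1 n) 1 (B.gen (c 0)) (B.basis n (Fin.tail c)) := by
  rw [gen, B.circ]
  congr 1
  ext k
  refine Fin.cases ?_ (fun k => ?_) k
  · simp [CubeCell.insert]
  · have : ((1 : Fin (1 + 1)) : ℕ) = 1 := rfl
    simp only [CubeCell.insert, Fin.tail, Fin.val_succ]
    split_ifs <;> first | omega | exact congrArg _ (Fin.ext (by simp))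

/-- The morphism out of an operad with a cube basis defined by operations that satisfy the
cubical relations. -/
noncomputable def homOfQuadAssoc {Q : NSOperad K} {g : IntervalCell → Q.op 1}
    (hg : Q.toSetOperad.QuadAssoc g) : Hom P Q where
  app n := (B.basis n).constr K (Q.toSetOperad.wordOp g n)
  app_one := by rw [← B.one, Module.Basis.constr_basis]; rfl
  app_circ {m n p} h i a b := by
    have : (P.circ h i).compr₂ ((B.basis p).constr K (Q.toSetOperad.wordOp g p)) =
        (Q.circ h i).compl₁₂ ((B.basis m).constr K (Q.toSetOperad.wordOp g m))
          ((B.basis n).constr K (Q.toSetOperad.wordOp g n)) := by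
      refine (B.basis m).ext fun c => (B.basis n).ext fun c' => ?_
      simp only [LinearMap.compr₂_apply, LinearMap.compl₁₂_apply, Module.Basis.constr_basis, B.circ]
      exact (Q.toSetOperad.wordOp_circ hg n m p h i c c').symm
    exact LinearMap.congr_fun₂ this a b

theorem hom_ext {Q : NSOperad K} (φ ψ : Hom P Q)
    (h : ∀ s, φ.app 1 (B.gen s) = ψ.app 1 (B.gen s)) : φ = ψ := by
  have key : ∀ n (c : CubeCell n), φ.app n (B.basis n c) = ψ.app n (B.basis n c) := by
    intro n
    induction n with
    | zero =>
      intro c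
      rw [Subsingleton.elim c Fin.elim0, B.one, φ.app_one, ψ.app_one]
    | succ n ih =>
      intro c
      rw [B.basis_succ, φ.app_circ, ψ.app_circ, h, ih]
  ext n a
  exact LinearMap.congr_fun ((B.basis n).ext (key n)) a

theorem isPresentedBy : P.IsPresentedBy B.gen (cubicalRelations K) where
  relations := (P.evalQuad_cubicalRelations_iff B.gen).2 B.quadAssoc_gen
  universal Q g' h := by
    refine ⟨B.homOfQuadAssoc ((Q.evalQuad_cubicalRelations_iff g').1 h), fun s => ?_,
      fun ψ hψ => B.hom_ext _ _ fun s => ?_⟩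
    · exact ((B.basis 1).constr_basis K _ _).trans (Q.toSetOperad.wordOp_one g' s)
    · rw [hψ]
      exact (((B.basis 1).constr_basis K _ _).trans (Q.toSetOperad.wordOp_one g' s)).symm

/-- `P` and `Q` are arbitrary here, so `P` also serves as its own Koszul dual. -/
theorem isKoszulDual {Q : NSOperad K} (B' : Q.CubeBasis) :
    IsKoszulDual P Q B.gen B'.gen (cubicalRelations K) where
  presented := B.isPresentedBy
  presented_dual := by rw [quadOrthogonal_cubicalRelations]; exact B'.isPresentedBy

end CubeBasis

end NSOperad

end

/-! ### Algebras -/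

section

variable {K : Type u} [Field K]

/-- The operad in sets of all maps `A ^ (n + 1) → A`, with composition by plugging. -/
def functionOperad (A : Type v) : SetOperad fun n => (Fin (n + 1) → A) → A where
  one v := v 0
  circ h i a b v := a (NSOperad.plug h i v b)
  one_circ {n} i a := by
    funext v
    simp only [NSOperad.plug]
    rw [if_neg (by omega), if_pos (by omega)]
    congr 1
    ext l
    exact congrArg v (Fin.ext (by simp))
  circ_one i a := by
    funext v
    congr 1
    ext k
    simp only [NSOperad.plug]
    split_ifs with h1 h2
    · rfl
    · subst h2; rfl
    · rfl
  circ_seq {m n l q s r} h₁ h₂ h₃ h₄ i j k hk a b c := by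
    funext v
    refine congrArg a (funext fun x => ?_)
    simp only [NSOperad.plug, Fin.lt_def, Fin.ext_iff]
    split_ifs with h1 h2 h3 h4
    all_goals first | omega | rfl | skip
    · refine congrArg b (funext fun y => ?_)
      simp only [NSOperad.plug, Fin.lt_def, Fin.ext_iff]
      split_ifs
      all_goals first | omega | rfl | skip
      · exact congrArg c (funext fun z => congrArg v (Fin.ext (by simp; omega)))
      · exact congrArg v (Fin.ext (by simp; omega))
    · exact congrArg v (Fin.ext (by simp; omega))
  circ_par {m n l q s r} h₁ h₂ h₃ h₄ i j i' j' hij hi hj a b c := by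
    funext v
    refine congrArg a (funext fun x => ?_)
    rw [Fin.lt_def] at hij
    simp only [NSOperad.plug, Fin.lt_def, Fin.ext_iff]
    split_ifs
    all_goals first | omega | rfl | skip
    · refine congrArg b (funext fun y => ?_)
      rw [if_pos (by omega)]
      exact congrArg v (Fin.ext (by simp; omega))
    · refine congrArg c (funext fun y => ?_)
      rw [if_neg (by omega), if_neg (by omega)]
      exact congrArg v (Fin.ext (by simp; omega))
    · exact congrArg v (Fin.ext (by simp; omega))

theorem update_pair_zero {A : Type v} (x y z : A) : Function.update ![x, y] 0 z = ![z, y] := by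
  funext k; fin_cases k <;> rfl

theorem update_pair_one {A : Type v} (x y z : A) : Function.update ![x, y] 1 z = ![x, z] := by
  funext k; fin_cases k <;> rfl

/-! ### Operations on a trialgebra named by words. -/

namespace CubicalTrialgebra

variable {A : Type v} [AddCommGroup A] [Module K A] (T : CubicalTrialgebra K A)

/-- The `n + 1`-ary operation on a cubical trialgebra named by a word of length `n`. -/
def wordFun (n : ℕ) (c : CubeCell n) : (Fin (n + 1) → A) → A :=
  (functionOperad A).wordOp (fun s v => T.bin s (v 0) (v 1)) n c

theorem wordFun_succ (n : ℕ) (c : CubeCell (n + 1)) (v : Fin (n + 2) → A) :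
    T.wordFun (n + 1) c v = T.bin (c 0) (v 0) (T.wordFun n (Fin.tail c) (Fin.tail v)) := by
  rw [wordFun, SetOperad.wordOp_succ]
  change T.bin (c 0) (NSOperad.plug _ _ _ _ 0) (NSOperad.plug _ _ _ _ 1) = _
  simp only [NSOperad.plug]
  rw [if_pos (by simp), if_neg (by simp), if_pos trivial]
  congr 1
  change T.wordFun n _ _ = T.wordFun n _ _
  congr 1
  ext l
  exact congrArg v (Fin.ext (by simp; omega))

theorem quadAssoc : (functionOperad A).QuadAssoc fun s v => T.bin s (v 0) (v 1) := by
  intro s t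
  funext v
  exact T.assoc s t (v 0) (v 1) (v 2)

theorem wordFun_circ {m n p : ℕ} (h : m + n = p) (i : Fin (m + 1)) (c : CubeCell m)
    (c' : CubeCell n) (v : Fin (p + 1) → A) :
    T.wordFun p (CubeCell.insert h i c c') v =
      T.wordFun m c (NSOperad.plug h i v (T.wordFun n c')) :=
  (congrFun ((functionOperad A).wordOp_circ T.quadAssoc n m p h i c c') v).symm

/-- `functionOperad` contains all maps, so multilinearity has to be recovered separately. It follows
by induction along the comb, since each letter acts bilinearly. -/
theorem wordFun_update_add : ∀ (n : ℕ) (c : CubeCell n) (v : Fin (n + 1) → A) (i : Fin (n + 1))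
    (x y : A), T.wordFun n c (Function.update v i (x + y)) =
      T.wordFun n c (Function.update v i x) + T.wordFun n c (Function.update v i y)
  | 0, c, v, i, x, y => by
    obtain rfl : i = 0 := Fin.fin_one_eq_zero i
    simp [wordFun, SetOperad.wordOp, functionOperad]
  | n + 1, c, v, i, x, y => by
    simp only [wordFun_succ]
    refine Fin.cases ?_ (fun i => ?_) i
    · simp
    · simp [Fin.tail_update_succ, wordFun_update_add n, (Fin.succ_ne_zero i).symm]

theorem wordFun_update_smul : ∀ (n : ℕ) (c : CubeCell n) (v : Fin (n + 1) → A) (i : Fin (n + 1))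
    (a : K) (x : A), T.wordFun n c (Function.update v i (a • x)) =
      a • T.wordFun n c (Function.update v i x)
  | 0, c, v, i, a, x => by
    obtain rfl : i = 0 := Fin.fin_one_eq_zero i
    simp [wordFun, SetOperad.wordOp, functionOperad]
  | n + 1, c, v, i, a, x => by
    simp only [wordFun_succ]
    refine Fin.cases ?_ (fun i => ?_) i
    · simp
    · simp [Fin.tail_update_succ, wordFun_update_smul n, (Fin.succ_ne_zero i).symm]

/-- `wordFun` as a multilinear map. -/
def wordMultilinear (n : ℕ) (c : CubeCell n) : MultilinearMap K (fun _ : Fin (n + 1) => A) A :=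
  MultilinearMap.mk' (T.wordFun n c) (T.wordFun_update_add n c) (T.wordFun_update_smul n c)

end CubicalTrialgebra

/-! ### Algebras over an operad with a cube basis. -/

namespace NSOperad.CubeBasis

variable {P : NSOperad K} (B : P.CubeBasis) {A : Type v} [AddCommGroup A] [Module K A]

theorem induction (n : ℕ) {motive : P.op n → Prop} (a : P.op n)
    (basis : ∀ c, motive (B.basis n c)) (zero : motive 0)
    (add : ∀ x y, motive x → motive y → motive (x + y))
    (smul : ∀ (k : K) x, motive x → motive (k • x)) : motive a :=
  Submodule.span_induction (p := fun x _ => motive x)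
    (by rintro _ ⟨c, rfl⟩; exact basis c) zero (fun x y _ _ => add x y) (fun k x _ => smul k x)
    ((B.basis n).mem_span a)

/-- Written as an update in slot `i`, the plugged vector lets multilinearity of the outer operation
give linearity in the inner one. -/
theorem plug_eq_update {m n p : ℕ} (h : m + n = p) (i : Fin (m + 1)) (v : Fin (p + 1) → A)
    (b : (Fin (n + 1) → A) → A) :
    plug h i v b = Function.update (plug h i v fun _ => 0) i
      (b fun l => v ⟨i + l, by omega⟩) := by
  funext k
  simp only [plug, Function.update_apply]
  split_ifs with h1 h2 <;> first | rfl | (subst h2; simp at h1)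

/-- The cubical trialgebra underlying an algebra. -/
noncomputable def trialgebra (α : P.Algebra A) : CubicalTrialgebra K A where
  bin s := LinearMap.mk₂ K (fun x y => α.act 1 (B.gen s) ![x, y])
    (fun x x' y => by
      rw [← update_pair_zero 0 y (x + x'), ← update_pair_zero 0 y x, ← update_pair_zero 0 y x']
      exact (α.act 1 (B.gen s)).map_update_add ![0, y] 0 x x')
    (fun a x y => by
      rw [← update_pair_zero 0 y (a • x), ← update_pair_zero 0 y x]
      exact (α.act 1 (B.gen s)).map_update_smul ![0, y] 0 a x)
    (fun x y y' => by
      rw [← update_pair_one x 0 (y + y'), ← update_pair_one x 0 y, ← update_pair_one x 0 y']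
      exact (α.act 1 (B.gen s)).map_update_add ![x, 0] 1 y y')
    (fun a x y => by
      rw [← update_pair_one x 0 (a • y), ← update_pair_one x 0 y]
      exact (α.act 1 (B.gen s)).map_update_smul ![x, 0] 1 a y)
  assoc s t x y z := by
    have h := DFunLike.congr_fun (congrArg (α.act 2) (B.quadAssoc_gen s t)) ![x, y, z]
    have h1 := α.act_circ (rfl : 1 + 1 = 2) 0 (B.gen t) (B.gen s) ![x, y, z]
    have h2 := α.act_circ (rfl : 1 + 1 = 2) 1 (B.gen s) (B.gen t) ![x, y, z]
    simp only [LinearMap.mk₂_apply]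
    refine Eq.trans (congrArg _ ?_) ((h1.symm.trans (h.trans h2)).trans (congrArg _ ?_))
    · funext k
      fin_cases k <;> simp [plug]
      congr 1
      funext l
      fin_cases l <;> rfl
    · funext k
      fin_cases k <;> simp [plug]
      congr 1
      funext l
      fin_cases l <;> rfl

/-- The algebra defined by a cubical trialgebra. -/
noncomputable def algebraOf (T : CubicalTrialgebra K A) : P.Algebra A where
  act n := (B.basis n).constr K (T.wordMultilinear n)
  act_one v := by
    rw [← B.one, Module.Basis.constr_basis]
    rfl
  act_circ {m n p} h i a b v := by
    induction a using B.induction with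
    | zero => simp
    | add x y hx hy => simp only [map_add, LinearMap.add_apply, add_apply, hx, hy]
    | smul k x hx => simp only [map_smul, LinearMap.smul_apply, smul_apply, hx]
    | basis c =>
      induction b using B.induction with
      | zero =>
        rw [plug_eq_update]
        simp
      | add x y hx hy =>
        rw [plug_eq_update] at hx hy ⊢
        simp only [map_add, add_apply, MultilinearMap.map_update_add, hx, hy]
      | smul k x hx =>
        rw [plug_eq_update] at hx ⊢
        simp only [map_smul, smul_apply, MultilinearMap.map_update_smul, hx]
      | basis c' =>
        rw [B.circ]
        simp only [Module.Basis.constr_basis]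
        exact T.wordFun_circ h i c c' v

/-- Compatibility with composition forces the action of a comb once the generators act as
prescribed. This gives uniqueness of the algebra structure and the comparison of morphisms. -/
theorem act_basis_eq_wordFun {α : P.Algebra A} {T : CubicalTrialgebra K A}
    (h : T.Induces B.gen α) : ∀ (n : ℕ) (c : CubeCell n) (v : Fin (n + 1) → A),
      α.act n (B.basis n c) v = T.wordFun n c v
  | 0, c, v => by
    rw [Subsingleton.elim c Fin.elim0, B.one, α.act_one]
    rfl
  | n + 1, c, v => by
    rw [B.basis_succ, α.act_circ, T.wordFun_succ, ← h]
    congr 1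
    funext k
    refine Fin.cases ?_ (fun k => ?_) k
    · simp [plug]
    · obtain rfl : k = 0 := Fin.fin_one_eq_zero k
      rw [plug, if_neg (by simp), if_pos (by rfl), act_basis_eq_wordFun h n]
      change T.wordFun n _ _ = T.wordFun n _ _
      congr 1
      ext l
      exact congrArg v (Fin.ext (by simp; omega))

theorem algebrasAreCubical : AlgebrasAreCubical.{u, v} P B.gen where
  trialgebra A _ _ α := by
    refine ⟨B.trialgebra α, fun s x y => rfl, fun T hT => ?_⟩
    ext s x y
    exact (hT s x y).symm
  algebra A _ _ T := by
    refine ⟨B.algebraOf T, fun s x y => ?_, fun α hα => ?_⟩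
    · exact (DFunLike.congr_fun ((B.basis 1).constr_basis K (T.wordMultilinear 1) _) _).trans rfl
    · ext n a v
      refine DFunLike.congr_fun (LinearMap.congr_fun
        ((B.basis n).ext (f₁ := α.act n) (f₂ := (B.algebraOf T).act n) fun c => ?_) a) v
      ext v
      rw [B.act_basis_eq_wordFun hα]
      exact (DFunLike.congr_fun ((B.basis n).constr_basis K (T.wordMultilinear n) _) v).symm
  hom A C _ _ _ _ α β S T hS hT f := by
    constructor
    · intro h s x y
      rw [← hS, ← hT, h]
      congr 1
      funext k
      fin_cases k <;> rfl
    · intro h n a v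
      have key : ∀ (n : ℕ) (c : CubeCell n) (v : Fin (n + 1) → A),
          f (S.wordFun n c v) = T.wordFun n c fun k => f (v k) := by
        intro n
        induction n with
        | zero => intro c v; rfl
        | succ n ih =>
          intro c v
          rw [S.wordFun_succ, T.wordFun_succ, h, ih]
          rfl
      induction a using B.induction with
      | zero => simp
      | add x y hx hy => simp only [map_add, add_apply, hx, hy]
      | smul k x hx => simp only [map_smul, smul_apply, hx]
      | basis c => rw [B.act_basis_eq_wordFun hS, B.act_basis_eq_wordFun hT, key]

end NSOperad.CubeBasis

end

/-! ### Words with marked letters -/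

/-- A word with `k` marked letters: the marked letters, and the `k + 1` blocks that they
separate. -/
abbrev MarkedWord (k : ℕ) : Type := CubeCell k × (Fin (k + 1) → List IntervalCell)

namespace MarkedWord

/-- Removal of the mark number `i`. -/
def face {k : ℕ} (i : Fin (k + 1)) (w : MarkedWord (k + 1)) : MarkedWord k :=
  (i.removeNth w.1, fun j =>
    if j < i then w.2 j.castSucc
    else if j = i then w.2 i.castSucc ++ w.1 i :: w.2 i.succ else w.2 j.succ)

/-- Adjunction of an unmarked letter at the beginning. -/
def cons {k : ℕ} (x : IntervalCell) (w : MarkedWord k) : MarkedWord k :=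
  (w.1, Fin.cons (x :: w.2 0) (Fin.tail w.2))

/-- Adjunction of a marked letter at the beginning. -/
def markCons {k : ℕ} (x : IntervalCell) (w : MarkedWord k) : MarkedWord (k + 1) :=
  (Fin.cons x w.1, Fin.cons [] w.2)

/-- This rule and the next two contain all the combinatorics of the complex: unmarking an initial
marked letter leaves it as an unmarked one, and all other faces ignore the initial letter. -/
theorem face_zero_markCons {k : ℕ} (x : IntervalCell) (w : MarkedWord k) :
    face 0 (markCons x w) = cons x w := by
  refine Prod.ext ?_ (funext fun j => ?_)
  · simp [face, markCons, cons]
  · refine Fin.cases ?_ (fun j => ?_) j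
    · simp [face, markCons, cons]
    · simp [face, markCons, cons, Fin.tail]

theorem face_succ_markCons {k : ℕ} (i : Fin (k + 1)) (x : IntervalCell) (w : MarkedWord (k + 1)) :
    face i.succ (markCons x w) = markCons x (face i w) := by
  refine Prod.ext ?_ (funext fun j => ?_)
  · refine funext fun j => ?_
    refine Fin.cases ?_ (fun j => ?_) j <;>
    simp [face, markCons, Fin.removeNth]
  · refine Fin.cases ?_ (fun j => ?_) j
    · simp [face, markCons]
    · simp [face, markCons]

theorem face_cons {k : ℕ} (i : Fin (k + 1)) (x : IntervalCell) (w : MarkedWord (k + 1)) :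
    face i (cons x w) = cons x (face i w) := by
  refine Prod.ext rfl (funext fun j => ?_)
  refine Fin.cases ?_ (fun j => ?_) j
  · refine Fin.cases ?_ (fun i => ?_) i
    · simp [face, cons, Fin.tail]
    · simp [face, cons]
  · refine Fin.cases ?_ (fun i => ?_) i
    · simp [face, cons, Fin.tail]
    · simp [face, cons, Fin.tail]

theorem eq_cons {k : ℕ} (w : MarkedWord k) (x : IntervalCell) (t : List IntervalCell)
    (h : w.2 0 = x :: t) : w = cons x (w.1, Fin.cons t (Fin.tail w.2)) := by
  refine Prod.ext rfl (funext fun j => ?_)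
  refine Fin.cases ?_ (fun j => ?_) j
  · simp [cons, h]
  · simp [cons, Fin.tail]

theorem eq_markCons {k : ℕ} (w : MarkedWord (k + 1)) (h : w.2 0 = []) :
    w = markCons (w.1 0) (Fin.tail w.1, Fin.tail w.2) := by
  refine Prod.ext (Fin.cons_self_tail w.1).symm (funext fun j => ?_)
  refine Fin.cases ?_ (fun j => ?_) j
  · simp [markCons, h]
  · simp [markCons, Fin.tail]

@[elab_as_elim]
-- In the base case the first block is empty: the word starts with a marked letter, or is empty if
-- there is no mark.
theorem induction_cons {k : ℕ} {motive : MarkedWord k → Prop}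
    (nil : ∀ w, w.2 0 = [] → motive w) (cons : ∀ x w, motive w → motive (cons x w))
    (w : MarkedWord k) : motive w := by
  obtain ⟨l, hl⟩ : ∃ l, w.2 0 = l := ⟨_, rfl⟩
  induction l generalizing w with
  | nil => exact nil w hl
  | cons x t ih =>
    rw [eq_cons w x t hl]
    exact cons _ _ (ih _ (by simp))

/-! ### The complex of marked words and its contraction. -/

section Complex

variable {K : Type u} [Field K] {M : ℕ → Type v} [∀ k, AddCommGroup (M k)] [∀ k, Module K (M k)]
  (e : ∀ k, Module.Basis (MarkedWord k) K (M k)) (d : ∀ k, M (k + 1) →ₗ[K] M k)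

/-- The differential is the alternating sum of the removals of marks. -/
def IsFaceDifferential : Prop :=
  ∀ k (w : MarkedWord (k + 1)),
    d k (e (k + 1) w) = ∑ i : Fin (k + 1), (-1 : K) ^ (i : ℕ) • e k (face i w)

/-- The linear extension of `cons`. -/
noncomputable def consLinear (x : IntervalCell) (k : ℕ) : M k →ₗ[K] M k :=
  (e k).constr K fun w => e k (cons x w)

/-- The linear extension of `markCons`. -/
noncomputable def markConsLinear (x : IntervalCell) (k : ℕ) : M k →ₗ[K] M (k + 1) :=
  (e k).constr K fun w => e (k + 1) (markCons x w)

/-- The contracting homotopy, which marks the first letter where possible. -/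
noncomputable def homotopy (k : ℕ) : M k →ₗ[K] M (k + 1) :=
  (e k).constr K fun w => match w.2 0 with
    | [] => 0
    | x :: t => e (k + 1) (markCons x (w.1, Fin.cons t (Fin.tail w.2)))

theorem consLinear_basis (x : IntervalCell) (k : ℕ) (w : MarkedWord k) :
    consLinear e x k (e k w) = e k (cons x w) :=
  (e k).constr_basis K _ w

theorem markConsLinear_basis (x : IntervalCell) (k : ℕ) (w : MarkedWord k) :
    markConsLinear e x k (e k w) = e (k + 1) (markCons x w) :=
  (e k).constr_basis K _ w

theorem homotopy_basis_of_nil (k : ℕ) (w : MarkedWord k) (h : w.2 0 = []) :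
    homotopy e k (e k w) = 0 := by
  rw [homotopy, Module.Basis.constr_basis, h]

theorem homotopy_consLinear (x : IntervalCell) (k : ℕ) (m : M k) :
    homotopy e k (consLinear e x k m) = markConsLinear e x k m := by
  revert m
  refine LinearMap.congr_fun (f := homotopy e k ∘ₗ consLinear e x k) ((e k).ext fun w => ?_)
  rw [LinearMap.comp_apply, consLinear_basis, markConsLinear_basis, homotopy,
    Module.Basis.constr_basis]
  simp [cons]

theorem homotopy_markConsLinear (x : IntervalCell) (k : ℕ) (m : M k) :
    homotopy e (k + 1) (markConsLinear e x k m) = 0 := by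
  revert m
  refine LinearMap.congr_fun (f := homotopy e (k + 1) ∘ₗ markConsLinear e x k) (g := 0)
    ((e k).ext fun w => ?_)
  rw [LinearMap.comp_apply, markConsLinear_basis, homotopy_basis_of_nil _ _ _ rfl]
  rfl

variable {e d} (hd : IsFaceDifferential e d)

include hd

theorem d_consLinear (x : IntervalCell) (k : ℕ) (m : M (k + 1)) :
    d k (consLinear e x (k + 1) m) = consLinear e x k (d k m) := by
  revert m
  refine LinearMap.congr_fun (f := d k ∘ₗ consLinear e x (k + 1)) (g := consLinear e x k ∘ₗ d k)
    ((e (k + 1)).ext fun w => ?_)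
  simp only [LinearMap.comp_apply, consLinear_basis, hd k, map_sum, map_smul, face_cons]

theorem d_zero_markConsLinear (x : IntervalCell) (m : M 0) :
    d 0 (markConsLinear e x 0 m) = consLinear e x 0 m := by
  revert m
  refine LinearMap.congr_fun (f := d 0 ∘ₗ markConsLinear e x 0) ((e 0).ext fun w => ?_)
  simp [LinearMap.comp_apply, consLinear_basis, markConsLinear_basis, hd 0, face_zero_markCons]

/-- This is the boundary formula of a cone: face `0` unmarks `x`, and the index shift by one in the
other faces produces the minus sign. -/
theorem d_succ_markConsLinear (x : IntervalCell) (k : ℕ) (m : M (k + 1)) :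
    d (k + 1) (markConsLinear e x (k + 1) m) =
      consLinear e x (k + 1) m - markConsLinear e x k (d k m) := by
  revert m
  refine LinearMap.congr_fun (f := d (k + 1) ∘ₗ markConsLinear e x (k + 1))
    (g := consLinear e x (k + 1) - markConsLinear e x k ∘ₗ d k) ((e (k + 1)).ext fun w => ?_)
  rw [LinearMap.comp_apply, LinearMap.sub_apply, LinearMap.comp_apply, markConsLinear_basis,
    consLinear_basis, hd, hd, Fin.sum_univ_succ, sub_eq_add_neg, map_sum, ← Finset.sum_neg_distrib]
  congr 1
  · simp [face_zero_markCons]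
  · refine Finset.sum_congr rfl fun i _ => ?_
    rw [map_smul, markConsLinear_basis, face_succ_markCons, Fin.val_succ, pow_succ, mul_neg_one,
      neg_smul]

/-- Write `x w` and `x̂ w` for `w` preceded by an unmarked or a marked letter, and `h` for the
homotopy. Then `d h (x w) = x w - x̂ (d w)` and `h d (x w) = x̂ (d w)`, while `h (x̂ w) = 0` and `h
d (x̂ w) = h (x w) - h (x̂ (d w)) = x̂ w`; in the lowest degree the term with `x̂ (d w)` is absent.
-/
theorem d_homotopy_add (k : ℕ) (m : M (k + 1)) :
    d (k + 1) (homotopy e (k + 1) m) + homotopy e k (d k m) = m := by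
  revert m
  refine LinearMap.congr_fun (f := d (k + 1) ∘ₗ homotopy e (k + 1) + homotopy e k ∘ₗ d k)
    (g := LinearMap.id) ((e (k + 1)).ext fun w => ?_)
  simp only [LinearMap.comp_apply, LinearMap.add_apply, LinearMap.id_apply]
  induction w using induction_cons with
  | nil w h =>
    rw [homotopy_basis_of_nil _ _ _ h, map_zero, zero_add, eq_markCons w h,
      ← markConsLinear_basis]
    cases k with
    | zero => rw [d_zero_markConsLinear hd, homotopy_consLinear]
    | succ k =>
      rw [d_succ_markConsLinear hd, map_sub, homotopy_consLinear, homotopy_markConsLinear,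
        sub_zero]
  | cons x w _ =>
    rw [← consLinear_basis, d_consLinear hd, homotopy_consLinear, homotopy_consLinear,
      d_succ_markConsLinear hd, sub_add_cancel]

/-- The cone formula replaces the simplicial identities: `d d (x̂ w) = d (x w) - d (x̂ (d w)) = x̂
(d d w)`, which vanishes by induction on the degree. Unmarked initial letters are carried along. -/
theorem d_comp_d (k : ℕ) (m : M (k + 2)) : d k (d (k + 1) m) = 0 := by
  induction k with
  | zero =>
    revert m
    refine LinearMap.congr_fun (f := d 0 ∘ₗ d 1) (g := 0) ((e 2).ext fun w => ?_)
    simp only [LinearMap.comp_apply, LinearMap.zero_apply]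
    induction w using induction_cons with
    | nil w h =>
      rw [eq_markCons w h, ← markConsLinear_basis, d_succ_markConsLinear hd, map_sub,
        d_consLinear hd, d_zero_markConsLinear hd, sub_self]
    | cons x w ih =>
      rw [← consLinear_basis, d_consLinear hd, d_consLinear hd, ih, map_zero]
  | succ k ihk =>
    revert m
    refine LinearMap.congr_fun (f := d (k + 1) ∘ₗ d (k + 2)) (g := 0)
      ((e (k + 3)).ext fun w => ?_)
    simp only [LinearMap.comp_apply, LinearMap.zero_apply]
    induction w using induction_cons with
    | nil w h =>
      rw [eq_markCons w h, ← markConsLinear_basis, d_succ_markConsLinear hd, map_sub,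
        d_consLinear hd, d_succ_markConsLinear hd, ihk, map_zero, sub_zero, sub_self]
    | cons x w ih =>
      rw [← consLinear_basis, d_consLinear hd, d_consLinear hd, ih, map_zero]

theorem exact_succ (k : ℕ) : Function.Exact (d (k + 1)) (d k) := by
  intro y
  constructor
  · intro h
    refine ⟨homotopy e (k + 1) y, ?_⟩
    have := d_homotopy_add hd k y
    rwa [h, map_zero, add_zero] at this
  · rintro ⟨z, rfl⟩
    exact d_comp_d hd k z

/-- Exactness in the lowest degree, for a map that kills the nonempty words and has a
retraction on the empty word. -/
theorem exact_zero {N : Type*} [AddCommMonoid N] [Module K N] (ε : M 0 →ₗ[K] N) (σ : N →ₗ[K] M 0)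
    (h_cons : ∀ x w, ε (e 0 (cons x w)) = 0) (h_nil : ∀ w, w.2 0 = [] → σ (ε (e 0 w)) = e 0 w) :
    Function.Exact (d 0) ε := by
  have key : ∀ y, d 0 (homotopy e 0 y) + σ (ε y) = y := by
    refine LinearMap.congr_fun (f := d 0 ∘ₗ homotopy e 0 + σ ∘ₗ ε) (g := LinearMap.id)
      ((e 0).ext fun w => ?_)
    simp only [LinearMap.comp_apply, LinearMap.add_apply, LinearMap.id_apply]
    induction w using induction_cons with
    | nil w h => rw [homotopy_basis_of_nil _ _ _ h, map_zero, zero_add, h_nil w h]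
    | cons x w _ =>
      rw [h_cons, map_zero, add_zero, ← consLinear_basis, homotopy_consLinear,
        d_zero_markConsLinear hd]
  intro y
  constructor
  · intro h
    refine ⟨homotopy e 0 y, ?_⟩
    have := key y
    rwa [h, map_zero, add_zero] at this
  · rintro ⟨z, rfl⟩
    revert z
    refine LinearMap.congr_fun (f := ε ∘ₗ d 0) (g := 0) ((e 1).ext fun w => ?_)
    simp only [LinearMap.comp_apply, LinearMap.zero_apply]
    induction w using induction_cons with
    | nil w h =>
      rw [eq_markCons w h, ← markConsLinear_basis, d_zero_markConsLinear hd, consLinear_basis,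
        h_cons]
    | cons x w _ =>
      rw [← consLinear_basis, d_consLinear hd]
      simp [hd 0, consLinear_basis, h_cons]

end Complex

end MarkedWord

/-! ### The Koszul complex -/

namespace NSOperad.CubeBasis

section

variable {K : Type u} [Field K] {P : NSOperad K} (B : P.CubeBasis)

/-- The words as a basis of the free algebra on one generator. -/
noncomputable def freeBasis : Module.Basis (List IntervalCell) K P.FreeOne :=
  (DFinsupp.basis B.basis).reindex List.equivSigmaTuple.symm

theorem freeBasis_ofFn (n : ℕ) (c : CubeCell n) :
    B.freeBasis (List.ofFn c) = DirectSum.lof K ℕ P.op n (B.basis n c) := by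
  have h : List.ofFn c = List.equivSigmaTuple.symm ⟨n, c⟩ := rfl
  rw [h, freeBasis, Module.Basis.reindex_apply, Equiv.symm_symm, Equiv.apply_symm_apply]
  refine (Module.Basis.apply_eq_iff (b := DFinsupp.basis B.basis)).2 ?_
  ext ⟨p, w⟩
  change (B.basis p).repr ((DFinsupp.single n (B.basis n c) : Π₀ n, P.op n) p) w = _
  by_cases hp : n = p
  · subst hp
    simp [Finsupp.single_apply]
  · rw [DFinsupp.single_eq_of_ne (Ne.symm hp), map_zero, Finsupp.single_eq_of_ne]
    · rfl
    · rintro ⟨⟩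
      exact hp rfl

/-- In `(x ∘₁ w) ∘₀ u` the first insertion puts `w` after the letter `x`, the second puts `u` before
it. -/
theorem freeBin_freeBasis (x : IntervalCell) (u w : List IntervalCell) :
    P.freeBin (B.gen x) (B.freeBasis u) (B.freeBasis w) = B.freeBasis (u ++ x :: w) := by
  have h : List.ofFn (CubeCell.insert rfl 0 (CubeCell.insert rfl (1 : Fin 2) (fun _ : Fin 1 => x)
      w.get) u.get) = u ++ x :: w := by
    refine List.ext_getElem (by simp; omega) fun k h1 h2 => ?_
    simp only [List.getElem_ofFn, CubeCell.insert, List.getElem_append, List.getElem_cons,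
      List.get_eq_getElem, Fin.val_zero, Fin.val_one, not_lt_zero, dite_false, zero_add, tsub_zero]
    split_ifs <;> first | omega | rfl | (exfalso; simp at h2; omega)
  have hu : B.freeBasis u = _ := (congrArg B.freeBasis (List.ofFn_get u)).symm.trans
    (B.freeBasis_ofFn u.length u.get)
  have hw : B.freeBasis w = _ := (congrArg B.freeBasis (List.ofFn_get w)).symm.trans
    (B.freeBasis_ofFn w.length w.get)
  rw [← h, freeBasis_ofFn, hu, hw, freeBin]
  simp only [DirectSum.toModule_lof, LinearMap.flip_apply, LinearMap.compr₂_apply,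
    LinearMap.comp_apply, B.circ, gen]

variable {Q : NSOperad K} (B' : Q.CubeBasis)

/-- The degree `k + 1` part of the Koszul complex. -/
abbrev KoszulModule (P Q : NSOperad K) (k : ℕ) : Type u :=
  TensorProduct K (Module.Dual K (Q.op k)) (PiTensorProduct K fun _ : Fin (k + 1) => P.FreeOne)

/-- The marked words as a basis of the Koszul complex. -/
noncomputable def koszulBasis (k : ℕ) : Module.Basis (MarkedWord k) K (KoszulModule P Q k) :=
  (B'.basis k).dualBasis.tensorProduct (Basis.piTensorProduct fun _ => B.freeBasis)

theorem koszulBasis_apply (k : ℕ) (w : MarkedWord k) :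
    B.koszulBasis B' k w = TensorProduct.tmul K ((B'.basis k).dualBasis w.1)
      (PiTensorProduct.tprod K fun j => B.freeBasis (w.2 j)) := by
  rw [koszulBasis, Module.Basis.tensorProduct_apply', Basis.piTensorProduct_apply]

/-- The functional dual to `c` sees a word with `x` inserted at place `i` only if that word is `c`,
that is, if `x` is the letter `c i` and the rest is `c` with this letter removed. -/
theorem dualMap_circ_dualBasis (k : ℕ) (i : Fin (k + 1)) (x : IntervalCell) (c : CubeCell (k + 1)) :
    ((Q.circ (m := k) (n := 1) rfl i).flip (B'.gen x)).dualMap ((B'.basis (k + 1)).dualBasis c) =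
      if x = c i then (B'.basis k).dualBasis (i.removeNth c) else 0 := by
  refine (B'.basis k).ext fun w => ?_
  rw [LinearMap.dualMap_apply, LinearMap.flip_apply, gen, B'.circ,
    Module.Basis.dualBasis_apply_self]
  have h1 : c.outer (rfl : k + 1 = k + 1) i = i.removeNth c := by
    ext j
    simp only [CubeCell.outer, Fin.removeNth, Fin.succAbove, Fin.lt_def, Fin.val_castSucc]
    split_ifs <;> rfl
  have h2 : c.inner (rfl : k + 1 = k + 1) i = (fun _ => x) ↔ x = c i := by
    constructor
    · intro h
      exact (congrFun h 0).symm
    · rintro rfl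
      ext j
      exact congrArg c (Fin.ext (by simp))
  simp only [@eq_comm _ _ c, CubeCell.eq_insert_iff, h1, h2]
  by_cases h3 : x = c i
  · rw [if_pos h3, Module.Basis.dualBasis_apply_self]
    simp [h3, eq_comm]
  · simp [h3]

theorem mergeMultilinear_freeBasis (k : ℕ) (i : Fin (k + 1)) (x : IntervalCell)
    (a : Fin (k + 2) → List IntervalCell) :
    PiTensorProduct.lift (mergeMultilinear (P.freeBin (B.gen x)) i)
      (PiTensorProduct.tprod K fun j => B.freeBasis (a j)) =
    PiTensorProduct.tprod K fun j : Fin (k + 1) => B.freeBasis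
      (if j < i then a j.castSucc else if j = i then a i.castSucc ++ x :: a i.succ
        else a j.succ) := by
  rw [PiTensorProduct.lift.tprod]
  refine congrArg (PiTensorProduct.tprod K) (funext fun j => ?_)
  simp only [freeBin_freeBasis, apply_ite B.freeBasis]

/-- For fixed `i` only the generator equal to the marked letter number `i` contributes to the sum
over `x`. The dual factor deletes this letter from the marks, and the product in the free algebra
puts it back, unmarked, between the two adjacent blocks. -/
theorem isFaceDifferential_koszulD :
    MarkedWord.IsFaceDifferential (M := KoszulModule P Q) (B.koszulBasis B') (koszulD P Q B.gen B'.gen) := by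
  intro k w
  rw [koszulD, LinearMap.sum_apply]
  refine Finset.sum_congr rfl fun i _ => ?_
  rw [LinearMap.smul_apply, LinearMap.sum_apply]
  congr 1
  rw [Finset.sum_eq_single (w.1 i)]
  · rw [koszulBasis_apply, TensorProduct.map_tmul, dualMap_circ_dualBasis, if_pos rfl,
      mergeMultilinear_freeBasis, koszulBasis_apply]
    rfl
  · intro x _ hx
    rw [koszulBasis_apply, TensorProduct.map_tmul, dualMap_circ_dualBasis, if_neg hx,
      TensorProduct.zero_tmul]
  · simp

/-- The section of the augmentation given by the inclusion of `P(1)` in the free algebra. -/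
noncomputable def koszulSection (P Q : NSOperad K) :
    TensorProduct K (Module.Dual K (Q.op 0)) (P.op 0) →ₗ[K] KoszulModule P Q 0 :=
  TensorProduct.map LinearMap.id
    ((PiTensorProduct.subsingletonEquiv (R := K) (s := fun _ : Fin 1 => P.FreeOne)
      (0 : Fin 1)).symm.toLinearMap ∘ₗ DirectSum.lof K ℕ P.op 0)

theorem exact_koszulAug :
    Function.Exact (koszulD P Q B.gen B'.gen 0) (koszulAug P Q) := by
  refine MarkedWord.exact_zero (B.isFaceDifferential_koszulD B') (koszulAug P Q)
    (koszulSection P Q) (fun x w => ?_) (fun w h => ?_)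
  · have h : DirectSum.component K ℕ P.op 0 (B.freeBasis (x :: w.2 0)) = 0 := by
      rw [← List.ofFn_get (x :: w.2 0), freeBasis_ofFn, DirectSum.component.of, dif_neg (by simp)]
    rw [koszulBasis_apply, koszulAug, TensorProduct.map_tmul, LinearMap.comp_apply,
      LinearEquiv.coe_coe, PiTensorProduct.subsingletonEquiv_apply_tprod]
    refine (congrArg _ ?_).trans (TensorProduct.tmul_zero _ _)
    exact h
  · have h : B.freeBasis (w.2 0) = DirectSum.lof K ℕ P.op 0 (B.basis 0 Fin.elim0) := by
      rw [h, ← freeBasis_ofFn, List.ofFn_zero]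
    rw [koszulBasis_apply, koszulAug, koszulSection, TensorProduct.map_tmul, TensorProduct.map_tmul,
      LinearMap.comp_apply, LinearMap.comp_apply,
      LinearEquiv.coe_coe, LinearEquiv.coe_coe, PiTensorProduct.subsingletonEquiv_apply_tprod, h,
      DirectSum.component.lof_self, LinearMap.id_apply, LinearMap.id_apply, ← h]
    refine congrArg _ ?_
    rw [LinearEquiv.symm_apply_eq]
    exact (PiTensorProduct.subsingletonEquiv_apply_tprod (0 : Fin 1)
      fun j : Fin 1 => B.freeBasis (w.2 j)).symm

/-- An operad with a cube basis is Koszul. -/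
theorem isKoszul (B : P.CubeBasis) : P.IsKoszul :=
  -- The relations being self-orthogonal, `P` with the same generators is taken as its own Koszul
  -- dual.
  ⟨IntervalCell, inferInstance, P, B.gen, B.gen, cubicalRelations K, B.isKoszulDual B,
    B.exact_koszulAug B, fun k => MarkedWord.exact_succ (B.isFaceDifferential_koszulD B) k⟩

end

end NSOperad.CubeBasis

/-! ### Filtrations and generating series -/

theorem CubeCell.dim_eq_sum {m : ℕ} (c : CubeCell m) :
    c.dim = ∑ k, if c k = .mid then 1 else 0 := by
  rw [dim, Finset.card_filter]

theorem CubeCell.dim_le {m : ℕ} (c : CubeCell m) : c.dim ≤ m :=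
  (Finset.card_filter_le _ _).trans (by simp)

theorem Finset.sum_range_remove_block (φ : ℕ → ℕ) {m n i : ℕ} (hi : i ≤ m) :
    ∑ k ∈ range m, φ (if k < i then k else k + n) + ∑ k ∈ range n, φ (i + k) =
      ∑ k ∈ range (m + n), φ k := by
  obtain ⟨l, rfl⟩ := Nat.exists_eq_add_of_le hi
  rw [add_assoc, add_comm l n, sum_range_add, sum_range_add _ i, sum_range_add _ n]
  have h1 : ∑ k ∈ range i, φ (if k < i then k else k + n) = ∑ k ∈ range i, φ k :=
    sum_congr rfl fun k hk => by rw [if_pos (mem_range.1 hk)]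
  have h2 : ∑ k ∈ range l, φ (if i + k < i then i + k else i + k + n) =
      ∑ k ∈ range l, φ (i + (n + k)) :=
    sum_congr rfl fun k _ => by rw [if_neg (by omega)]; congr 1; omega
  rw [h1, h2]
  ring

theorem CubeCell.dim_outer_add_dim_inner {m n p : ℕ} (h : m + n = p) (i : Fin (m + 1))
    (w : CubeCell p) : (w.outer h i).dim + (w.inner h i).dim = w.dim := by
  subst h
  -- The indicator of the letters `mid`, extended by zero to all natural numbers, turns the three
  -- counts into sums over ranges.
  let φ : ℕ → ℕ := fun k => if h : k < m + n then (if w ⟨k, h⟩ = .mid then 1 else 0) else 0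
  have h1 : ∀ k : Fin m, (if w.outer rfl i k = .mid then 1 else 0) =
      φ (if (k : ℕ) < i then k else k + n) := by
    intro k
    simp only [φ, outer]
    split_ifs <;> omega
  have h2 : ∀ k : Fin n, (if w.inner rfl i k = .mid then 1 else 0) = φ (i + k) := by
    intro k
    simp only [φ, inner]
    rw [dif_pos (by omega)]
    rfl
  have h3 : ∀ k : Fin (m + n), (if w k = .mid then 1 else 0) = φ k := by
    intro k
    simp only [φ]
    rw [dif_pos k.2]
  rw [dim_eq_sum, dim_eq_sum, dim_eq_sum]
  simp only [h1, h2, h3]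
  rw [Fin.sum_univ_eq_sum_range (fun k => φ (if k < i then k else k + n)),
    Fin.sum_univ_eq_sum_range (fun k => φ (i + k)), Fin.sum_univ_eq_sum_range φ,
    Finset.sum_range_remove_block φ (Nat.lt_succ_iff.1 i.2)]

theorem CubeCell.dim_insert {m n p : ℕ} (h : m + n = p) (i : Fin (m + 1)) (c : CubeCell m)
    (c' : CubeCell n) : (insert h i c c').dim = c.dim + c'.dim := by
  obtain ⟨h1, h2⟩ := (eq_insert_iff h i (insert h i c c') c c').1 rfl
  rw [← dim_outer_add_dim_inner h i, h1, h2]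

/-- Each monomial is a product over the letters, so the sum is the expansion of the `n`-th power of
the one-letter sum `1 + 1 + t`. -/
theorem CubeCell.sum_X_pow_dim (n : ℕ) :
    ∑ c : CubeCell n, (Polynomial.X : Polynomial ℤ) ^ c.dim = (Polynomial.X + 2) ^ n := by
  have h : ∀ c : CubeCell n, (Polynomial.X : Polynomial ℤ) ^ c.dim =
      ∏ k, if c k = .mid then Polynomial.X else 1 := by
    intro c
    rw [Finset.prod_ite, Finset.prod_const, Finset.prod_const_one, mul_one, dim]
  simp only [h]
  have hs : ∑ s : IntervalCell, (if s = .mid then (Polynomial.X : Polynomial ℤ) else 1) =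
      Polynomial.X + 2 := by
    change (if IntervalCell.left = .mid then (Polynomial.X : Polynomial ℤ) else 1) +
      ((if IntervalCell.right = .mid then Polynomial.X else 1) + (Polynomial.X + 0)) = _
    rw [if_neg (by decide), if_neg (by decide)]
    ring
  rw [← Fintype.sum_pow (fun s : IntervalCell => if s = .mid then (Polynomial.X : Polynomial ℤ)
    else 1) n, hs]

/-! ### Filtrations by dimension, Poincaré polynomials and the generating series. -/

section

variable {K : Type u} [Field K]

/-- The Poincaré polynomial of a filtration whose steps are counted by the cells of bounded
dimension. -/
theorem poincarePolynomial_eq {M : Type v} [AddCommGroup M] [Module K M] [FiniteDimensional K M]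
    (n : ℕ) (F : ℕ → Submodule K M) (hF : Monotone F)
    (h : ∀ i, Module.finrank K (F i) = Fintype.card {c : CubeCell n // c.dim ≤ i}) :
    poincarePolynomial F = (Polynomial.X + 2) ^ n := by
  have h1 : ∀ i, Module.finrank K (F i ⧸ (if i = 0 then ⊥ else F (i - 1)).submoduleOf (F i)) =
      Fintype.card {c : CubeCell n // c.dim = i} := by
    intro i
    have h2 := Submodule.finrank_quotient_add_finrank
      ((if i = 0 then ⊥ else F (i - 1)).submoduleOf (F i))
    have h3 : (if i = 0 then ⊥ else F (i - 1)) ≤ F i := by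
      split_ifs
      · exact bot_le
      · exact hF (Nat.sub_le _ _)
    rw [(Submodule.submoduleOfEquivOfLe h3).finrank_eq, h] at h2
    -- Step `0` is separate: the preceding step is `⊥`, and `dim ≤ 0` means `dim = 0`.
    cases i with
    | zero => simpa using h2
    | succ i =>
      have h4 : Fintype.card {c : CubeCell n // c.dim ≤ i + 1} =
          Fintype.card {c : CubeCell n // c.dim ≤ i} +
            Fintype.card {c : CubeCell n // c.dim = i + 1} := by
        simp only [Fintype.card_subtype]
        rw [← Finset.card_union_of_disjoint]
        · congr 1
          ext c
          simp only [Finset.mem_filter, Finset.mem_union, Finset.mem_univ, true_and]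
          omega
        · rw [Finset.disjoint_left]
          simp
          omega
      rw [if_neg (Nat.succ_ne_zero i), Nat.add_sub_cancel, h, h4] at h2
      rw [if_neg (Nat.succ_ne_zero i), Nat.add_sub_cancel]
      omega
  have h5 : ∀ i, (Polynomial.monomial i (Fintype.card {c : CubeCell n // c.dim = i} : ℤ)) =
      ∑ c : CubeCell n, if c.dim = i then (Polynomial.X : Polynomial ℤ) ^ c.dim else 0 := by
    intro i
    rw [← Finset.sum_filter, Finset.sum_congr rfl (g := fun _ => (Polynomial.X : Polynomial ℤ) ^ i)
      (fun c hc => by rw [(Finset.mem_filter.1 hc).2]), Finset.sum_const, Fintype.card_subtype,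
      ← Polynomial.C_mul_X_pow_eq_monomial, nsmul_eq_mul]
    simp
  rw [poincarePolynomial]
  simp only [h1, h5]
  rw [finsum_eq_sum_of_support_subset (s := Finset.range (n + 1)), Finset.sum_comm,
    ← CubeCell.sum_X_pow_dim]
  · refine Finset.sum_congr rfl fun c _ => ?_
    rw [Finset.sum_ite_eq, if_pos]
    exact Finset.mem_range.2 (Nat.lt_succ_of_le c.dim_le)
  · intro i hi
    by_contra hn
    refine hi (Finset.sum_eq_zero fun c _ => if_neg ?_)
    rintro rfl
    exact hn (by simpa using Nat.lt_succ_of_le c.dim_le)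

theorem finrank_supported_cells {n : ℕ} (p : CubeCell n → Prop) [DecidablePred p] :
    Module.finrank K (Finsupp.supported K K {c : CubeCell n | p c}) =
      Fintype.card {c : CubeCell n // p c} := by
  rw [(Finsupp.supportedEquivFinsupp {c : CubeCell n | p c}).finrank_eq]
  rw [Module.finrank_finsupp_self]
  rfl

theorem chainFiltration_monotone (n : ℕ) : Monotone (chainFiltration K n) := fun _ _ hij =>
  Finsupp.supported_mono fun _ hc => le_trans hc hij

theorem cochainFiltration_monotone (n : ℕ) : Monotone (cochainFiltration K n) := fun _ _ hij =>
  Submodule.dualAnnihilator_anti (Finsupp.supported_mono fun _ hc => lt_of_le_of_lt hij hc)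

theorem mem_cochainFiltration {n i : ℕ} (f : CubeCochain K n) :
    f ∈ cochainFiltration K n i ↔ ∀ c : CubeCell n, i < c.dim → f (Finsupp.single c 1) = 0 := by
  rw [cochainFiltration]
  refine (Submodule.mem_dualAnnihilator f).trans ?_
  rw [Finsupp.supported_eq_span_single]
  constructor
  · exact fun h c hc => h _ (Submodule.subset_span ⟨c, hc, rfl⟩)
  · intro h x hx
    have : Submodule.span K ((fun c : CubeCell n => Finsupp.single c (1 : K)) ''
        {c : CubeCell n | i < c.dim}) ≤ LinearMap.ker f := by
      refine Submodule.span_le.2 ?_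
      rintro _ ⟨c, hc, rfl⟩
      exact h c hc
    exact this hx

theorem isFiltration_chainFiltration : (cubeChainOperad K).IsFiltration (chainFiltration K) where
  mono := chainFiltration_monotone
  exhaustive n := ⟨n, by
    rw [chainFiltration, Set.eq_univ_of_forall (s := {c : CubeCell n | c.dim ≤ n})
      CubeCell.dim_le]
    exact Finsupp.supported_univ⟩
  one_mem := Finsupp.single_mem_supported K 1 (CubeCell.dim_le _)
  circ_mem {m n p} h i s t a ha b hb := by
    have key : Submodule.map₂ (cubeChainCirc K h i)
        (Finsupp.supported K K {c : CubeCell m | c.dim ≤ s})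
        (Finsupp.supported K K {c : CubeCell n | c.dim ≤ t}) ≤
        Finsupp.supported K K {c : CubeCell p | c.dim ≤ s + t} := by
      rw [Finsupp.supported_eq_span_single K {c : CubeCell m | c.dim ≤ s},
        Finsupp.supported_eq_span_single K {c : CubeCell n | c.dim ≤ t}, Submodule.map₂_span_span,
        Submodule.span_le]
      rintro _ ⟨_, ⟨c, hc, rfl⟩, _, ⟨c', hc', rfl⟩, rfl⟩
      refine (congrArg (· ∈ _) (cubeChainCirc_single K h i c c' 1 1)).mpr ?_
      refine Finsupp.single_mem_supported K _ ?_
      rw [Set.mem_ofPred_eq, CubeCell.dim_insert]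
      exact Nat.add_le_add hc hc'
    exact key (Submodule.apply_mem_map₂ _ ha hb)

theorem isFiltration_cochainFiltration :
    (cubeCochainOperad K).IsFiltration (cochainFiltration K) where
  mono := cochainFiltration_monotone
  exhaustive n := ⟨n, eq_top_iff.2 fun f _ =>
    (mem_cochainFiltration f).2 fun c hc => absurd c.dim_le (not_le.2 hc)⟩
  one_mem := (mem_cochainFiltration _).2 fun c hc => absurd c.dim_le (not_le.2 hc)
  circ_mem {m n p} h i s t a ha b hb := by
    refine (mem_cochainFiltration _).2 fun c hc => ?_
    refine (cubeCochainCirc_single K h i a b c).trans ?_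
    rw [← CubeCell.dim_outer_add_dim_inner h i c] at hc
    -- As the dimensions of the two pieces add up to more than `s + t`, the outer one exceeds `s` or
    -- the inner one exceeds `t`; the corresponding factor vanishes.
    rcases lt_or_ge s (c.outer h i).dim with h1 | h1
    · exact mul_eq_zero_of_left ((mem_cochainFiltration a).1 ha _ h1) _
    · exact mul_eq_zero_of_right _ ((mem_cochainFiltration b).1 hb _ (by omega))

theorem poincarePolynomial_chainFiltration (n : ℕ) :
    poincarePolynomial (chainFiltration K n) = (Polynomial.X + 2) ^ n := by
  have : FiniteDimensional K ((cubeChainOperad K).op n) :=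
    inferInstanceAs (FiniteDimensional K (CubeChain K n))
  exact poincarePolynomial_eq n _ (chainFiltration_monotone n) fun i =>
    finrank_supported_cells fun c => c.dim ≤ i

theorem poincarePolynomial_cochainFiltration (n : ℕ) :
    poincarePolynomial (cochainFiltration K n) = (Polynomial.X + 2) ^ n := by
  have : FiniteDimensional K ((cubeCochainOperad K).op n) :=
    inferInstanceAs (FiniteDimensional K (CubeCochain K n))
  refine poincarePolynomial_eq n _ (cochainFiltration_monotone n) fun i => ?_
  have h := Subspace.finrank_add_finrank_dualAnnihilator_eq
    (Finsupp.supported K K {c : CubeCell n | i < c.dim})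
  rw [finrank_supported_cells fun c : CubeCell n => i < c.dim, Module.finrank_finsupp_self] at h
  have h' := Fintype.card_subtype_compl fun c : CubeCell n => i < c.dim
  have h'' := Fintype.card_subtype_le fun c : CubeCell n => i < c.dim
  simp only [not_lt] at h'
  rw [h']
  exact (Nat.sub_eq_of_eq_add' h.symm).symm

/-- A power series `f` with `f (1 + a x) = -x` is an involution for composition. -/
theorem PowerSeries.subst_self_of_mul_eq_neg_X {R : Type*} [CommRing R] (a : R)
    (f : PowerSeries R) (h : f * (1 + C a * X) = -X) (h0 : HasSubst f) :
    subst f f = (X : PowerSeries R) := by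
  have h1 := congrArg (subst f) h
  rw [subst_mul h0, subst_add h0, subst_mul h0, subst_X h0, ← coe_substAlgHom h0, map_neg,
    coe_substAlgHom h0, subst_X h0, ← coe_substAlgHom h0, map_one, coe_substAlgHom h0] at h1
  have h2 : subst f (C a : PowerSeries R) = C a := subst_C a
  rw [h2] at h1
  -- Multiplying `f(f) (1 + a f) = -f`, obtained by substitution, by `1 + a X` gives `f(f) = -f (1 +
  -- a X) = X`, because `1 + a f` and `1 + a X` are inverse to each other.
  have h3 : (1 + C a * f) * (1 + C a * X) = 1 := by linear_combination (C a) * h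
  linear_combination (1 + C a * X) * h1 - subst f f * h3 - h

/-- The power series `-x / (1 + (t + 2) x)`. -/
noncomputable def cubicalSeries : PowerSeries (Polynomial ℤ) :=
  PowerSeries.mk fun n => Nat.casesOn n 0 fun n => (-1) ^ (n + 1) * (Polynomial.X + 2) ^ n

theorem genSeries_eq {P : NSOperad K} {F : ∀ n, ℕ → Submodule K (P.op n)}
    (h : ∀ n, poincarePolynomial (F n) = (Polynomial.X + 2) ^ n) :
    NSOperad.genSeries F = cubicalSeries := by
  refine PowerSeries.ext fun n => ?_
  rw [NSOperad.genSeries, cubicalSeries, PowerSeries.coeff_mk, PowerSeries.coeff_mk]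
  cases n with
  | zero => rfl
  | succ n => exact congrArg ((-1) ^ (n + 1) * ·) (h n)

theorem constantCoeff_cubicalSeries : PowerSeries.constantCoeff cubicalSeries = 0 := by
  rw [← PowerSeries.coeff_zero_eq_constantCoeff_apply, cubicalSeries, PowerSeries.coeff_mk]
  rfl

theorem cubicalSeries_mul :
    cubicalSeries * (1 + PowerSeries.C (Polynomial.X + 2 : Polynomial ℤ) * PowerSeries.X) =
      -PowerSeries.X := by
  rw [mul_add, mul_one, ← mul_assoc]
  ext1 n
  rcases n with _ | _ | n
  · simp [constantCoeff_cubicalSeries]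
  · simp [PowerSeries.coeff_succ_mul_X, cubicalSeries]
  · rw [map_add, PowerSeries.coeff_succ_mul_X, PowerSeries.coeff_mul_C, map_neg,
      PowerSeries.coeff_X, if_neg (by omega), cubicalSeries, PowerSeries.coeff_mk, PowerSeries.coeff_mk]
    ring

end

theorem mainTheorem9 (K : Type u) [Field K] :
    -- three generating operations, the cells of the interval, and nine relations
    Fintype.card IntervalCell = 3 ∧
    Module.finrank K (cubicalRelations K) = 9 ∧
    -- the chain operad is presented by them, and the cochain operad is its Koszul dual
    NSOperad.IsKoszulDual (cubeChainOperad K) (cubeCochainOperad K) (chainGen K) (cochainGen K)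
      (cubicalRelations K) ∧
    -- the algebras are the cubical trialgebras
    AlgebrasAreCubical.{u, v} (cubeChainOperad K) (chainGen K) ∧
    AlgebrasAreCubical.{u, v} (cubeCochainOperad K) (cochainGen K) ∧
    -- both operads are Koszul
    (cubeChainOperad K).IsKoszul ∧
    (cubeCochainOperad K).IsKoszul ∧
    -- both are filtered by the dimension of the cells, with the common generating series
    -- `f = -x / (1 + (t + 2) x)`, which is its own inverse for composition
    (cubeChainOperad K).IsFiltration (chainFiltration K) ∧
    (cubeCochainOperad K).IsFiltration (cochainFiltration K) ∧
    ∃ f : PowerSeries (Polynomial ℤ),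
      NSOperad.genSeries (chainFiltration K) = f ∧
      NSOperad.genSeries (cochainFiltration K) = f ∧
      f * (1 + PowerSeries.C (Polynomial.X + 2 : Polynomial ℤ) * PowerSeries.X) =
        -PowerSeries.X ∧
      PowerSeries.HasSubst f ∧
      PowerSeries.subst f f = (PowerSeries.X : PowerSeries (Polynomial ℤ)) := by
  refine ⟨rfl, NSOperad.finrank_cubicalRelations, ?_, ?_, ?_, (cubeChainBasis K).isKoszul,
    (cubeCochainBasis K).isKoszul, isFiltration_chainFiltration, isFiltration_cochainFiltration,
    _, genSeries_eq poincarePolynomial_chainFiltration,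
    genSeries_eq poincarePolynomial_cochainFiltration, cubicalSeries_mul, ?_, ?_⟩
  · rw [← funext cubeChainBasis_gen, ← funext cubeCochainBasis_gen]
    exact (cubeChainBasis K).isKoszulDual (cubeCochainBasis K)
  · rw [← funext cubeChainBasis_gen]
    exact (cubeChainBasis K).algebrasAreCubical
  · rw [← funext cubeCochainBasis_gen]
    exact (cubeCochainBasis K).algebrasAreCubical
  · exact PowerSeries.HasSubst.of_constantCoeff_zero' constantCoeff_cubicalSeries
  · exact PowerSeries.subst_self_of_mul_eq_neg_X _ _ cubicalSeries_mul
      (PowerSeries.HasSubst.of_constantCoeff_zero' constantCoeff_cubicalSeries)
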